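/- Let $X=\{0,1\}^{\mathbb N}$ with the product topology and let $\sigma$ be the shift, $\sigma(x)_i=x_{i+1}$. For $T:X\to X$, let $\omega(x)$ be the set of accumulation points of $(T^n(x))_{n\ge 0}$, and for closed $A\subset X$ let $\rho(A)=\{x:\omega(x)\subset A\}$. A map $T:X\to X$ is *computable* if there are computable functions $\alpha:\mathbb N\to\mathbb N$ and $\beta:\{0,1\}^*\to\{0,1\}$ with $T(x)_n=\beta(x_0\dots x_{\alpha(n)})$ for all $x,n$. For a word $w$ let $[w]=\{x\in X: x \text{ begins with } w\}$. A closed set $K\subset X$ is *$\Pi_1$* if $\{w:[w]\cap K\neq\emptyset\}$ is a $\Pi_1$ set of words, and *$\Pi_1$-complete* if moreover for every $\Pi_1$ closed set $K'\subset X$ the set $\{w:[w]\cap K'\ne\emptyset\}$ is many-one reducible to $\{w:[w]\cap K\ne\emptyset\}$. A closed set $A$ is the *topological attractor* if $\rho(A)$ is generic (residual) and $\rho(A')$ is meager for every closed $A'\subsetneq A$; it is the *metric attractor* with respect to a probability measure $\lambda$ if $\rho(A)$ has full $\lambda$-measure and $\rho(A')$ is $\lambda$-null for every closed $A'\subsetneq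 A$. A *physical measure* with respect to $\lambda$ is a $T$-invariant Borel probability measure $\mu$ such that $\frac1n\sum_{i<n}\delta_{T^i(x)}\to\mu$ weakly for $\lambda$-almost every $x$; $A$ is the *statistical attractor* with respect to $\lambda$ if there is a unique physical measure with support $A$. $A$ is *strongly attracting* if there is an open $U\supset A$ with $T(\overline U)\subset U$ and $A=\bigcap_n T^n(U)$. A Borel probability measure $\mu$ is *computable* if the numbers $\mu([w_1]\cup\dots\cup[w_m])$ are lower computable uniformly in $(w_1,\dots,w_m)$, i.e. some algorithm outputs on input $w_1,\dots,w_m,k$ a rational number whose supremum over $k$ is this measure. **Theorem.** There exist a computable map $T:X\to X$ and a subshift (closed shift-invariant set) $A\subset X$ with $T(A)=A$ such that: 1. $A$ is $\Pi_1$-complete. 2. $A$ is the topological attractor of $T$, and it is the metric attractor of $T$ with respect to every $\sigma$-ergodic probability measure of full support. Moreover $T|_A=\sigma|_A$, and $T|_A$ is topologically mixing and has positive topological entropy. 3. $A$ is strongly attracting, and $\omega(x)\subset A$ for every $x\in X$. 4. For every $\sigma$-ergodic probability measure $\lambda$ of full support, $A$ is the statistical attractor of $T$ with respect to $\lambda$;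 moreover $T$ has a unique physical measure with respect to $\lambda$, and this measure is not computable. -/

import Mathlib

open Set Filter Topology MeasureTheory
open scoped NNReal

/-- The Cantor space of infinite binary sequences, with its product topology, uniformity and
Borel sigma-algebra. -/
abbrev BinSeq : Type := ℕ → Bool

/-- The word formed by the first `n` symbols of `x`. -/
def prefixWord (x : BinSeq) (n : ℕ) : List Bool := (List.range n).map x

/-- The cylinder `[w]` of the sequences that begin with `w`. These clopen sets are the ideal
balls of the Cantor space; they are indexed by the finite words. -/
def cylinder (w : List Bool) : Set BinSeq := {x | prefixWord x w.length = w}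

/-- The shift map. -/
def shift (x : BinSeq) : BinSeq := fun n => x (n + 1)

/-- A map of the Cantor space is computable if there are computable functions `α`, `β` such
that the `n`-th symbol of `T x` is `β (x₀ … x_{α n})`. -/
def IsComputableMap (T : BinSeq → BinSeq) : Prop :=
  ∃ (α : ℕ → ℕ) (β : List Bool → Bool), Computable α ∧ Computable β ∧
    ∀ x n, T x n = β (prefixWord x (α n + 1))

/-- `S` is a `Π₁` set: `a ∈ S ↔ ∀ j, f a j = 1` for a computable `f` with values in `{0, 1}`. -/
def IsPiOnePred {α : Type*} [Primcodable α] (S : α → Prop) : Prop :=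
  ∃ f : α → ℕ → Bool, Computable₂ f ∧ ∀ a, S a ↔ ∀ j, f a j = true

/-- The ideal balls that meet `K`. As cylinders are clopen, it does not matter whether balls
or their closures are used. -/
def MeetsCylinder (K : Set BinSeq) (w : List Bool) : Prop := (cylinder w ∩ K).Nonempty

/-- A closed set is `Π₁` if it is a `Π₁` property of an ideal ball to meet it, that is, if the
ideal balls that are disjoint from it can be enumerated. -/
def IsPiOne (K : Set BinSeq) : Prop :=
  IsClosed K ∧ IsPiOnePred (MeetsCylinder K)

/-- A closed set is `Π₁`-complete if it is `Π₁` and each `Π₁` closed set reduces to it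
(many-one, as collections of ideal balls). -/
def IsPiOneComplete (K : Set BinSeq) : Prop :=
  IsPiOne K ∧ ∀ K' : Set BinSeq, IsPiOne K' → ManyOneReducible (MeetsCylinder K') (MeetsCylinder K)

/-- A subshift: a closed shift-invariant set. -/
def IsSubshift (A : Set BinSeq) : Prop := IsClosed A ∧ MapsTo shift A A

section Dynamics

variable {X : Type*} [TopologicalSpace X]

/-- The set `ω(x)` of accumulation points of the sequence `x, T x, T (T x), …`. -/
def omegaSet (T : X → X) (x : X) : Set X := {y | MapClusterPt y atTop (fun n : ℕ => T^[n] x)}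

/-- The realm of topological attraction `ρ(A)`. -/
def realm (T : X → X) (A : Set X) : Set X := {x | omegaSet T x ⊆ A}

/-- The realm of `A` is generic, and the realm of no strictly smaller closed set is
non-meager. -/
def IsTopologicalAttractor (T : X → X) (A : Set X) : Prop :=
  IsClosed A ∧ realm T A ∈ residual X ∧
    ∀ A' : Set X, IsClosed A' → A' ⊂ A → IsMeagre (realm T A')

/-- The realm of `A` has full measure, and the realm of no strictly smaller closed set has
positive measure. -/
def IsMetricAttractor [MeasurableSpace X] (T : X → X) (lam : Measure X) (A : Set X) : Prop :=
  IsClosed A ∧ lam (realm T A)ᶜ = 0 ∧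
    ∀ A' : Set X, IsClosed A' → A' ⊂ A → lam (realm T A') = 0

/-- There is an open neighbourhood `U` of `A` with `T (closure U) ⊆ U` and
`A = ⋂ n, T^n (U)`. -/
def IsStronglyAttracting (T : X → X) (A : Set X) : Prop :=
  ∃ U : Set X, IsOpen U ∧ A ⊆ U ∧ T '' closure U ⊆ U ∧ A = ⋂ n : ℕ, T^[n] '' U

/-- The restriction of `T` to the invariant set `A` is topologically mixing. -/
def IsTopologicallyMixingOn (T : X → X) (A : Set X) : Prop :=
  ∀ U V : Set X, IsOpen U → IsOpen V → (U ∩ A).Nonempty → (V ∩ A).Nonempty →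
    ∃ N : ℕ, ∀ n ≥ N, (T^[n] '' (U ∩ A) ∩ (V ∩ A)).Nonempty

variable [MeasurableSpace X]

/-- The empirical measure `ν_n(x) = (1 / n) ∑_{i < n} δ_{T^i x}` (it is zero for `n = 0`). -/
noncomputable def empiricalMeasure (T : X → X) (x : X) (n : ℕ) : FiniteMeasure X :=
  (n : ℝ≥0)⁻¹ • ∑ i ∈ Finset.range n, (diracProba (T^[i] x)).toFiniteMeasure

/-- `μ` is an invariant probability measure that is the weak limit of the empirical measures
of almost every point with respect to the reference measure `lam`. -/
def IsPhysicalMeasure [OpensMeasurableSpace X] (T : X → X) (lam : Measure X)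
    (μ : ProbabilityMeasure X) : Prop :=
  MeasurePreserving T (μ : Measure X) (μ : Measure X) ∧
    ∀ᵐ x ∂lam, Tendsto (empiricalMeasure T x) atTop (𝓝 μ.toFiniteMeasure)

/-- There is a unique invariant measure with support `A` that is the weak limit of the
empirical measures of almost every point. -/
def IsStatisticalAttractor [OpensMeasurableSpace X] (T : X → X) (lam : Measure X)
    (A : Set X) : Prop :=
  IsClosed A ∧
    ∃! μ : ProbabilityMeasure X, IsPhysicalMeasure T lam μ ∧ (μ : Measure X).support = A

end Dynamics

/-- A probability measure is computable if the measures of finite unions of ideal balls are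
uniformly lower computable: some algorithm maps a finite list of ideal balls and `k` to a
rational `p / (q + 1)` whose supremum over `k` is the measure of the union. -/
def IsComputableMeasure (μ : ProbabilityMeasure BinSeq) : Prop :=
  ∃ f : List (List Bool) → ℕ → ℕ × ℕ, Computable₂ f ∧
    ∀ L : List (List Bool),
      IsLUB (range fun k : ℕ => ((f L k).1 : ℝ) / (((f L k).2 : ℝ) + 1))
        ((μ : Measure BinSeq).real (⋃ w ∈ L, cylinder w))

/-!
The map is `T = erase D ∘ shift`. The patterns are the words `11(01)ᵏ1`, and a pattern occurs in a
sequence when the sequence has ones at the places of its ones. For an increasing sequence of finite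
sets `D n` with union `S`, `erase D` deletes the letter at `n` when a pattern with index in `D n`
starts there. Deleting ones creates no pattern, and the sets `D n` grow, so after the first step the
map only shifts (`eraseShift_iterate_succ`). The orbit then avoids more and more patterns, and
`A = avoiding S` is the intersection of the images of the whole space; on `A` the map is the shift.

The patterns have no two consecutive zeros, so sequences can be glued across a gap `00` without
creating one (`Occurs.of_splice`). This gives mixing, the density needed for the topological
attractor, and the fact that a word meets `A` as soon as no listed pattern occurs in it. Sequences
without `11` contain no pattern at all, which gives entropy. As no pattern occurs in another one,
the word `11(01)ᵏ1` meets `A` exactly when `k ∉ S`; with the halting set for `S`, the set `A` is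
`Π₁`-complete.

For an ergodic `lam` of full support, the physical measure is the image of `lam` under the erasure
of all patterns with index in `S`, an operation that commutes with the shift. At a late time, the
orbit of `x` under `T` differs from the orbit of the erased sequence only near a long pattern
(`shift_iterate_mem_longPattern`). Long patterns are rare, since almost every sequence contains
`00`; so Birkhoff's ergodic theorem, proved here for ergodic probability measures, shows that
almost every orbit is distributed according to that measure. Its support is `A`, and if it were
computable, the words that meet `A` could be enumerated, and so could the complement of the halting
set.
-/

/-! ### The pointwise ergodic theorem -/

section Birkhoff

variable {X : Type*} {T : X → X}

/-- `maxSum T g n x` is the largest of the Birkhoff sums `S₀ g x = 0, S₁ g x, …, Sₙ g x`; the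
definition is the recursion `M₍ₙ₊₁₎ = max 0 (g + Mₙ ∘ T)`. -/
noncomputable def maxSum (T : X → X) (g : X → ℝ) : ℕ → X → ℝ
  | 0, _ => 0
  | n + 1, x => max 0 (g x + maxSum T g n (T x))

theorem maxSum_nonneg (g : X → ℝ) (n : ℕ) (x : X) : 0 ≤ maxSum T g n x := by
  cases n with
  | zero => exact le_rfl
  | succ n => exact le_max_left _ _

theorem maxSum_le_succ (g : X → ℝ) (n : ℕ) (x : X) :
    maxSum T g n x ≤ maxSum T g (n + 1) x := by
  induction n generalizing x with
  | zero => exact maxSum_nonneg g 1 x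
  | succ n ih => exact max_le_max le_rfl (by have := ih (T x); linarith)

theorem birkhoffSum_le_maxSum (g : X → ℝ) (n : ℕ) (x : X) :
    birkhoffSum T g n x ≤ maxSum T g n x := by
  induction n generalizing x with
  | zero => simp [maxSum]
  | succ n ih =>
    rw [birkhoffSum_succ']
    exact le_trans (by have := ih (T x); linarith) (le_max_right _ _)

variable [MeasurableSpace X] {lam : Measure X}

theorem birkhoffSum_measurable (hT : Measurable T) {f : X → ℝ} (hf : Measurable f) (n : ℕ) :
    Measurable (birkhoffSum T f n) := by
  unfold birkhoffSum
  exact Finset.measurable_sum _ fun i _ => hf.comp (hT.iterate i)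

theorem maxSum_integrable (hT : MeasurePreserving T lam lam) {g : X → ℝ}
    (hg : Integrable g lam) (n : ℕ) : Integrable (maxSum T g n) lam := by
  induction n with
  | zero => exact integrable_zero _ _ _
  | succ n ih =>
    exact (integrable_zero X ℝ lam).sup (hg.add (hT.integrable_comp_of_integrable ih))

/-- If almost every orbit has unbounded Birkhoff sums of `g`, then `g` has nonnegative integral:
`M₍ₙ₊₁₎ - Mₙ ∘ T` has nonnegative integral, and it converges to `g` wherever `Mₙ ∘ T → ∞`. -/
theorem integral_nonneg_of_unbounded_birkhoffSum (hT : MeasurePreserving T lam lam) {g : X → ℝ}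
    (hg : Integrable g lam)
    (h : ∀ᵐ x ∂lam, ∀ K : ℝ, ∃ n, K < birkhoffSum T g n (T x)) : 0 ≤ ∫ x, g x ∂lam := by
  have key : ∀ n x, maxSum T g (n + 1) x - maxSum T g n (T x) =
      max (-maxSum T g n (T x)) (g x) := by
    intro n x
    change max 0 (g x + maxSum T g n (T x)) - _ = _
    rw [max_sub_sub_right 0 (g x + maxSum T g n (T x)) (maxSum T g n (T x)) |>.symm]
    simp
  have hint := fun n => maxSum_integrable hT hg n
  have hlim : Tendsto (fun n => ∫ x, (maxSum T g (n + 1) x - maxSum T g n (T x)) ∂lam) atTop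
      (𝓝 (∫ x, g x ∂lam)) := by
    refine tendsto_integral_of_dominated_convergence (fun x => |g x|) (fun n => ?_) hg.abs
      (fun n => ?_) ?_
    · exact ((hint (n + 1)).sub (hT.integrable_comp_of_integrable (hint n))).aestronglyMeasurable
    · refine Eventually.of_forall fun x => ?_
      rw [key, Real.norm_eq_abs, abs_le]
      have := maxSum_nonneg (T := T) g n (T x)
      refine ⟨(neg_abs_le _).trans (le_max_right _ _), max_le ?_ (le_abs_self _)⟩
      have := abs_nonneg (g x)
      linarith
    · filter_upwards [h] with x hx
      refine tendsto_const_nhds.congr' ?_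
      obtain ⟨N, hN⟩ := hx (-g x)
      filter_upwards [eventually_ge_atTop N] with n hn
      rw [key, max_eq_right]
      have h1 := monotone_nat_of_le_succ (f := fun n => maxSum T g n (T x))
        (fun n => maxSum_le_succ g n (T x)) hn
      have h2 := birkhoffSum_le_maxSum (T := T) g N (T x)
      simp only at h1
      linarith
  refine ge_of_tendsto' hlim fun n => ?_
  rw [integral_sub (g := fun x => maxSum T g n (T x)) (hint (n + 1))
    (hT.integrable_comp_of_integrable (hint n)), sub_nonneg]
  have : ∫ x, maxSum T g n (T x) ∂lam = ∫ x, maxSum T g n x ∂lam := by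
    conv_rhs => rw [← hT.map_eq]
    rw [integral_map hT.measurable.aemeasurable]
    rw [hT.map_eq]; exact (hint n).aestronglyMeasurable
  rw [this]
  exact integral_mono (hint n) (hint (n + 1)) fun x => maxSum_le_succ g n x

/-- For an ergodic map, the Birkhoff sums of a function with negative integral are almost
everywhere bounded above. -/
theorem ae_bddAbove_birkhoffSum [IsProbabilityMeasure lam] (hT : Ergodic T lam) {g : X → ℝ}
    (hgm : Measurable g) (hg : Integrable g lam) (hneg : ∫ x, g x ∂lam < 0) :
    ∀ᵐ x ∂lam, ∃ K : ℝ, ∀ n, birkhoffSum T g n x ≤ K := by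
  set E : Set X := {x | ∀ K : ℕ, ∃ n, (K : ℝ) < birkhoffSum T g n x} with hE
  have hEm : MeasurableSet E := by
    simp only [hE, ofPred_forall, ofPred_exists]
    exact MeasurableSet.iInter fun K => MeasurableSet.iUnion fun n =>
      measurableSet_lt measurable_const (birkhoffSum_measurable hT.measurable hgm n)
  have hinv : T ⁻¹' E = E := by
    ext x
    simp only [hE, mem_preimage, mem_ofPred_eq]
    constructor
    · intro h K
      obtain ⟨L, hL⟩ := exists_nat_gt (K - g x)
      obtain ⟨n, hn⟩ := h L
      exact ⟨n + 1, by rw [birkhoffSum_succ']; linarith⟩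
    · intro h K
      obtain ⟨L, hL⟩ := exists_nat_gt (K + |g x|)
      obtain ⟨n, hn⟩ := h L
      cases n with
      | zero =>
        have h0 : (0 : ℝ) ≤ K := K.cast_nonneg
        have := abs_nonneg (g x)
        rw [birkhoffSum_zero] at hn; linarith
      | succ n =>
        rw [birkhoffSum_succ'] at hn
        exact ⟨n, by have := le_abs_self (g x); linarith⟩
  rcases hT.toPreErgodic.ae_empty_or_univ hEm hinv with h | h
  · have : ∀ᵐ x ∂lam, x ∉ E := by
      filter_upwards [h] with x hx hxE
      exact (iff_of_eq hx).1 hxE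
    filter_upwards [this] with x hx
    simp only [hE, mem_ofPred_eq, not_forall, not_exists, not_lt] at hx
    exact hx.imp' (fun K : ℕ => (K : ℝ)) fun _ h => h
  · refine absurd (integral_nonneg_of_unbounded_birkhoffSum hT.toMeasurePreserving hg ?_)
      hneg.not_ge
    filter_upwards [h] with x hx K
    have hxE : T x ∈ E := by
      have : x ∈ T ⁻¹' E := by rw [hinv]; exact (iff_of_eq hx).2 trivial
      exact this
    obtain ⟨L, hL⟩ := exists_nat_gt K
    obtain ⟨n, hn⟩ := hxE L
    exact ⟨n, hL.trans hn⟩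

/-- One half of the pointwise ergodic theorem. -/
theorem ae_eventually_birkhoffAverage_le [IsProbabilityMeasure lam] (hT : Ergodic T lam)
    {f : X → ℝ} (hfm : Measurable f) (hf : Integrable f lam) {ε : ℝ} (hε : 0 < ε) :
    ∀ᵐ x ∂lam, ∀ᶠ n : ℕ in atTop, birkhoffAverage ℝ T f n x ≤ ∫ x, f x ∂lam + ε := by
  -- the Birkhoff sums of `f - c` are bounded above, because its integral is `-ε / 2`
  set c := ∫ x, f x ∂lam + ε / 2 with hc
  have hneg : ∫ x, (f x - c) ∂lam < 0 := by
    rw [integral_sub hf (integrable_const c)]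
    simp [hc, hε]
  filter_upwards [ae_bddAbove_birkhoffSum hT (hfm.sub measurable_const)
    (hf.sub (integrable_const c)) hneg] with x ⟨K, hK⟩
  obtain ⟨N, hN⟩ := exists_nat_gt (K / (ε / 2))
  filter_upwards [eventually_ge_atTop N, eventually_gt_atTop 0] with n hn hn0
  have hS : birkhoffSum T f n x ≤ K + n * c := by
    have := hK n
    simp only [birkhoffSum, Pi.sub_apply, Finset.sum_sub_distrib, Finset.sum_const,
      Finset.card_range, nsmul_eq_mul] at this ⊢
    linarith
  have hn0' : (0 : ℝ) < n := by exact_mod_cast hn0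
  have hnN : (N : ℝ) ≤ n := by exact_mod_cast hn
  rw [birkhoffAverage, smul_eq_mul, inv_mul_le_iff₀ hn0']
  rw [div_lt_iff₀ (by positivity)] at hN
  have : (N : ℝ) * (ε / 2) ≤ n * (ε / 2) := by gcongr
  calc _ ≤ K + n * c := hS
    _ ≤ n * (ε / 2) + n * c := by linarith
    _ = _ := by rw [hc]; ring

/-- **Pointwise ergodic theorem** of Birkhoff, for an ergodic probability measure. -/
theorem ae_tendsto_birkhoffAverage [IsProbabilityMeasure lam] (hT : Ergodic T lam)
    {f : X → ℝ} (hfm : Measurable f) (hf : Integrable f lam) :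
    ∀ᵐ x ∂lam, Tendsto (fun n => birkhoffAverage ℝ T f n x) atTop (𝓝 (∫ x, f x ∂lam)) := by
  have h1 : ∀ᵐ x ∂lam, ∀ k : ℕ, ∀ᶠ n : ℕ in atTop,
      birkhoffAverage ℝ T f n x ≤ ∫ x, f x ∂lam + 1 / (k + 1) :=
    ae_all_iff.2 fun k => ae_eventually_birkhoffAverage_le hT hfm hf (by positivity)
  have h2 : ∀ᵐ x ∂lam, ∀ k : ℕ, ∀ᶠ n : ℕ in atTop,
      birkhoffAverage ℝ T (-f) n x ≤ ∫ x, (-f) x ∂lam + 1 / (k + 1) :=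
    ae_all_iff.2 fun k => ae_eventually_birkhoffAverage_le hT hfm.neg hf.neg (by positivity)
  filter_upwards [h1, h2] with x hx1 hx2
  rw [tendsto_order]
  constructor
  · intro a ha
    obtain ⟨k, hk⟩ := exists_nat_one_div_lt (sub_pos.2 ha)
    filter_upwards [hx2 k] with n hn
    simp only [birkhoffAverage_neg, Pi.neg_apply, integral_neg] at hn
    linarith
  · intro a ha
    obtain ⟨k, hk⟩ := exists_nat_one_div_lt (sub_pos.2 ha)
    filter_upwards [hx1 k] with n hn
    linarith

end Birkhoff

/-! ### Patterns -/

/-- The pattern `11(01)ᵏ1` occurs in `x` at position `p`: the letters of `x` at the positions of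
its ones are `1`. The letters of `x` at the positions of its zeros are arbitrary. -/
def Occurs (k : ℕ) (x : BinSeq) (p : ℕ) : Prop :=
  x p = true ∧ x (p + 2 * k + 2) = true ∧ ∀ i < k + 1, x (p + 1 + 2 * i) = true

/-- The sequences in which no pattern with index in `S` occurs. -/
def avoiding (S : Set ℕ) : Set BinSeq := {x | ∀ k ∈ S, ∀ p, ¬ Occurs k x p}

open Classical in
/-- Replace by `0` the first letter of each pattern of `x` whose index is in `D n`, `n` being the
position where it occurs. -/
noncomputable def erase (D : ℕ → Set ℕ) (x : BinSeq) : BinSeq :=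
  fun n => x n && !decide (∃ k ∈ D n, Occurs k x n)

/-- The shift followed by the erasure of the patterns listed in `D`. -/
noncomputable def eraseShift (D : ℕ → Set ℕ) (x : BinSeq) : BinSeq := erase D (shift x)

/-- The sequence that agrees with `x` on `[0, m)`, vanishes on `[m, t)`, and continues with `y`
from position `t` on. -/
def splice (x : BinSeq) (m t : ℕ) (y : BinSeq) : BinSeq :=
  fun i => if i < m then x i else if i < t then false else y (i - t)

/-- The word `w` followed by zeros. -/
def zeroExtend (w : List Bool) : BinSeq := fun i => w.getD i false

theorem Occurs.mono {k p : ℕ} {x y : BinSeq} (h : Occurs k x p)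
    (hxy : ∀ n ≥ p, x n = true → y n = true) : Occurs k y p :=
  ⟨hxy _ le_rfl h.1, hxy _ (by omega) h.2.1, fun i hi => hxy _ (by omega) (h.2.2 i hi)⟩

theorem Occurs.congr {k p n : ℕ} {x y : BinSeq} (h : Occurs k x p) (hn : p + 2 * k + 2 < n)
    (hxy : ∀ i < n, x i = y i) : Occurs k y p :=
  ⟨by rw [← hxy _ (by omega)]; exact h.1, by rw [← hxy _ (by omega)]; exact h.2.1,
    fun i hi => by rw [← hxy _ (by omega)]; exact h.2.2 i hi⟩

theorem shift_iterate_apply (t : ℕ) (x : BinSeq) (n : ℕ) : shift^[t] x n = x (n + t) := by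
  induction t generalizing x with
  | zero => rfl
  | succ t ih => rw [Function.iterate_succ_apply, ih]; exact congrArg x (by omega)

theorem occurs_of_shift_eq {k p q t : ℕ} {x y : BinSeq} (hq : q = p + t)
    (h : ∀ n, y n = x (n + t)) : Occurs k y p ↔ Occurs k x q := by
  subst hq
  unfold Occurs
  simp only [h]
  rw [show p + 2 * k + 2 + t = p + t + 2 * k + 2 by omega]
  refine and_congr Iff.rfl (and_congr Iff.rfl (forall_congr' fun i => ?_))
  rw [show p + 1 + 2 * i + t = p + t + 1 + 2 * i by omega]

theorem occurs_shift_iff {k p : ℕ} {x : BinSeq} : Occurs k (shift x) p ↔ Occurs k x (p + 1) :=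
  occurs_of_shift_eq (t := 1) rfl fun _ => rfl

theorem occurs_shift_iterate_iff {k p t : ℕ} {x : BinSeq} :
    Occurs k (shift^[t] x) p ↔ Occurs k x (p + t) :=
  occurs_of_shift_eq rfl (shift_iterate_apply t x)

/-- The patterns have no two consecutive zeros, so none straddles the gap of a spliced sequence. -/
theorem Occurs.of_splice {k p m t : ℕ} {x y : BinSeq} (ht : m + 2 ≤ t)
    (h : Occurs k (splice x m t y) p) :
    (p + 2 * k + 2 < m ∧ Occurs k x p) ∨ (t ≤ p ∧ Occurs k y (p - t)) := by
  have h0 : ∀ i, m ≤ i → i < t → splice x m t y i = false := fun i h1 h2 => by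
    simp [splice, h2, Nat.not_lt.2 h1]
  obtain ⟨ha, hb, hc⟩ := h
  by_cases hp : p < m
  · by_cases hm : p + 2 * k + 2 < m
    · refine .inl ⟨hm, Occurs.congr (x := splice x m t y) ⟨ha, hb, hc⟩ hm fun i hi => ?_⟩
      simp [splice, hi]
    · exfalso
      -- one of the positions `m`, `m + 1` holds a one of the pattern
      rcases Nat.even_or_odd' (m - p) with ⟨c, hc' | hc'⟩
      · by_cases hck : c < k + 1
        · have := hc c hck
          rw [h0 _ (by omega) (by omega)] at this
          exact absurd this (by decide)
        · rw [h0 _ (by omega) (by omega)] at hb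
          exact absurd hb (by decide)
      · have := hc c (by omega)
        rw [h0 _ (by omega) (by omega)] at this
        exact absurd this (by decide)
  · have hpt : t ≤ p := by
      by_contra hlt
      rw [h0 _ (by omega) (by omega)] at ha
      exact absurd ha (by decide)
    refine .inr ⟨hpt, (occurs_of_shift_eq (x := splice x m t y) (q := p) (t := t) (by omega)
      fun n => ?_).2 ⟨ha, hb, hc⟩⟩
    simp [splice, show ¬ n + t < m by omega]

theorem zeroExtend_eq_splice (w : List Bool) {t : ℕ} :
    zeroExtend w = splice (zeroExtend w) w.length t (fun _ => false) := by
  funext i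
  simp only [zeroExtend, splice]
  split_ifs with h
  · rfl
  all_goals exact List.getD_eq_default _ _ (not_lt.1 h)

/-- A pattern in a word followed by zeros lies within the word. -/
theorem Occurs.lt_length {k p : ℕ} {w : List Bool} (h : Occurs k (zeroExtend w) p) :
    p + 2 * k + 2 < w.length := by
  rw [zeroExtend_eq_splice w (t := w.length + 2)] at h
  rcases h.of_splice le_rfl with h | h
  · exact h.1
  · exact absurd h.2.1 Bool.false_ne_true

/-! ### Cylinders -/

theorem mem_cylinder_iff {w : List Bool} {x : BinSeq} :
    x ∈ cylinder w ↔ ∀ i < w.length, x i = zeroExtend w i := by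
  change prefixWord x w.length = w ↔ _
  constructor
  · intro h i hi
    have : w.getD i false = (prefixWord x w.length).getD i false := by rw [h]
    rw [zeroExtend, this]
    simp [prefixWord, hi]
  · intro h
    refine List.ext_getElem (by simp [prefixWord]) fun i h1 h2 => ?_
    simp [prefixWord, h i h2, zeroExtend, h2]

theorem zeroExtend_mem_cylinder (w : List Bool) : zeroExtend w ∈ cylinder w :=
  mem_cylinder_iff.2 fun _ _ => rfl

@[simp] theorem prefixWord_length (x : BinSeq) (n : ℕ) : (prefixWord x n).length = n := by
  simp [prefixWord]

theorem zeroExtend_prefixWord {x : BinSeq} {n i : ℕ} (hi : i < n) :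
    zeroExtend (prefixWord x n) i = x i := by
  simp [zeroExtend, prefixWord, hi]

theorem mem_cylinder_prefixWord {x y : BinSeq} {n : ℕ} :
    y ∈ cylinder (prefixWord x n) ↔ ∀ i < n, y i = x i := by
  rw [mem_cylinder_iff, prefixWord_length]
  exact forall₂_congr fun i hi => by rw [zeroExtend_prefixWord hi]

theorem isClopen_letter (n : ℕ) (b : Bool) : IsClopen {x : BinSeq | x n = b} :=
  (isClopen_discrete {b}).preimage (continuous_apply n)

theorem isClopen_cylinder (w : List Bool) : IsClopen (cylinder w) := by
  have : cylinder w = ⋂ i ∈ Finset.range w.length, {x : BinSeq | x i = zeroExtend w i} := by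
    ext x; simp [mem_cylinder_iff]
  rw [this]
  exact isClopen_biInter_finset fun i _ => isClopen_letter i _

theorem exists_cylinder_subset {x : BinSeq} {U : Set BinSeq} (hU : IsOpen U) (hx : x ∈ U) :
    ∃ n, ∀ y : BinSeq, (∀ i < n, y i = x i) → y ∈ U := by
  obtain ⟨_, ⟨⟨z, n, rfl⟩, hxz, hzU⟩⟩ :=
    (PiNat.isTopologicalBasis_cylinders (fun _ : ℕ => Bool)).exists_subset_of_mem_open hx hU
  exact ⟨n, fun y hy => hzU fun i hi => (hy i hi).trans (hxz i hi)⟩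

/-! ### Erasing patterns -/

section Erase

variable {D : ℕ → Set ℕ} {x : BinSeq}

theorem erase_le {n : ℕ} (h : erase D x n = true) : x n = true := by
  simp only [erase, Bool.and_eq_true] at h
  exact h.1

theorem not_occurs_erase {k n : ℕ} (hk : k ∈ D n) : ¬ Occurs k (erase D x) n := by
  intro h
  have h1 : Occurs k x n := h.mono fun _ _ => erase_le
  have h2 := h.1
  simp only [erase, Bool.and_eq_true, Bool.not_eq_true', decide_eq_false_iff_not] at h2
  exact h2.2 ⟨k, hk, h1⟩

theorem erase_apply_of_not_occurs {n : ℕ} (h : ∀ k ∈ D n, ¬ Occurs k x n) :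
    erase D x n = x n := by
  have : ¬ ∃ k ∈ D n, Occurs k x n := fun ⟨k, hk, h'⟩ => h k hk h'
  simp [erase, this]

theorem erase_congr {D' : ℕ → Set ℕ} {n : ℕ} (h : ∀ k, Occurs k x n → (k ∈ D n ↔ k ∈ D' n)) :
    erase D x n = erase D' x n := by
  unfold erase
  congr 3
  exact propext ⟨fun ⟨k, hk, ho⟩ => ⟨k, (h k ho).1 hk, ho⟩,
    fun ⟨k, hk, ho⟩ => ⟨k, (h k ho).2 hk, ho⟩⟩

theorem erase_shift_apply {S : Set ℕ} (n : ℕ) :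
    erase (fun _ => S) (shift x) n = erase (fun _ => S) x (n + 1) := by
  unfold erase
  congr 3
  exact propext (exists_congr fun k => and_congr Iff.rfl occurs_shift_iff)

theorem erase_const_shift_iterate {S : Set ℕ} (t n : ℕ) :
    erase (fun _ => S) (shift^[t] x) n = erase (fun _ => S) x (n + t) := by
  induction t generalizing x with
  | zero => rfl
  | succ t ih =>
    rw [Function.iterate_succ_apply, ih, erase_shift_apply]
    exact congrArg (erase (fun _ => S) x) (by omega)

theorem erase_const_mem_avoiding (S : Set ℕ) (x : BinSeq) : erase (fun _ => S) x ∈ avoiding S :=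
  fun _ hk _ => not_occurs_erase (D := fun _ => S) hk

/-- No pattern that was erased once reappears: after the first step, the map is a shift. This uses
that the pattern lists grow with the position. -/
theorem eraseShift_iterate_succ (hD : Monotone D) (t : ℕ) (x : BinSeq) :
    (eraseShift D)^[t + 1] x = shift^[t] (erase D (shift x)) := by
  induction t with
  | zero => rfl
  | succ t ih =>
    rw [Function.iterate_succ_apply', ih, eraseShift, ← Function.iterate_succ_apply' shift]
    funext n
    refine erase_apply_of_not_occurs fun k hk ho => ?_
    rw [occurs_shift_iterate_iff] at ho
    exact not_occurs_erase (hD (Nat.le_add_right n (t + 1)) hk) ho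

theorem eraseShift_iterate_apply (hD : Monotone D) {t : ℕ} (ht : t ≠ 0) (x : BinSeq) (n : ℕ) :
    (eraseShift D)^[t] x n = erase D (shift x) (n + (t - 1)) := by
  obtain ⟨t, rfl⟩ := Nat.exists_eq_succ_of_ne_zero ht
  rw [Nat.succ_eq_add_one, eraseShift_iterate_succ hD, shift_iterate_apply]
  rfl

theorem not_occurs_eraseShift_iterate (hD : Monotone D) {t k n : ℕ} (hk : k ∈ D t) :
    ¬ Occurs k ((eraseShift D)^[t + 1] x) n := by
  rw [eraseShift_iterate_succ hD, occurs_shift_iterate_iff]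
  exact not_occurs_erase (hD (Nat.le_add_left t n) hk)

/-- Any prefix can be continued so that the orbit hits a given point of `avoiding S` exactly. -/
theorem eraseShift_iterate_splice (hD : Monotone D) {S : Set ℕ} (hS : ∀ n, D n ⊆ S) {m t : ℕ}
    (ht : m + 2 ≤ t) {y : BinSeq} (hy : y ∈ avoiding S) :
    (eraseShift D)^[t] (splice x m t y) = y := by
  funext n
  rw [eraseShift_iterate_apply hD (by omega), erase_apply_of_not_occurs]
  · change splice x m t y (n + (t - 1) + 1) = y n
    rw [show n + (t - 1) + 1 = n + t by omega]
    simp [splice, show ¬ n + t < m by omega]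
  · intro k hk ho
    rw [occurs_shift_iff] at ho
    rcases ho.of_splice ht with h | h
    · omega
    · exact hy k (hS _ hk) _ h.2

end Erase

/-! ### Sequences avoiding patterns -/

section Avoiding

variable {S : Set ℕ} {x y : BinSeq}

theorem isClopen_setOf_occurs (k p : ℕ) : IsClopen {x : BinSeq | Occurs k x p} := by
  have h : ∀ i : ℕ, IsClopen {x : BinSeq | x i = true} := fun i => isClopen_letter i true
  have : {x : BinSeq | Occurs k x p} = {x | x p = true} ∩ ({x | x (p + 2 * k + 2) = true} ∩
      ⋂ i ∈ Finset.range (k + 1), {x | x (p + 1 + 2 * i) = true}) := by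
    ext x; simp [Occurs]
  rw [this]
  exact (h _).inter ((h _).inter (isClopen_biInter_finset fun i _ => h _))

theorem isClosed_avoiding (S : Set ℕ) : IsClosed (avoiding S) := by
  have : avoiding S = ⋂ k ∈ S, ⋂ p, {x | Occurs k x p}ᶜ := by
    ext x; simp [avoiding]
  rw [this]
  exact isClosed_biInter fun k _ => isClosed_iInter fun p =>
    (isClopen_setOf_occurs k p).compl.isClosed

theorem shift_mem_avoiding (hx : x ∈ avoiding S) : shift x ∈ avoiding S :=
  fun k hk _ ho => hx k hk _ (occurs_shift_iff.1 ho)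

theorem isSubshift_avoiding (S : Set ℕ) : IsSubshift (avoiding S) :=
  ⟨isClosed_avoiding S, fun _ => shift_mem_avoiding⟩

theorem splice_mem_avoiding {m t : ℕ} (ht : m + 2 ≤ t) (hx : x ∈ avoiding S)
    (hy : y ∈ avoiding S) : splice x m t y ∈ avoiding S := by
  intro k hk p ho
  rcases ho.of_splice ht with h | h
  · exact hx k hk _ h.2
  · exact hy k hk _ h.2

theorem splice_apply_lt {m t i : ℕ} (hi : i < m) : splice x m t y i = x i := by
  simp [splice, hi]

theorem shift_iterate_splice {m t : ℕ} (ht : m ≤ t) : shift^[t] (splice x m t y) = y := by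
  funext n
  rw [shift_iterate_apply]
  simp [splice, show ¬ n + t < m by omega]

theorem meetsCylinder_avoiding_iff {w : List Bool} :
    MeetsCylinder (avoiding S) w ↔ ∀ k ∈ S, ∀ p, ¬ Occurs k (zeroExtend w) p := by
  constructor
  · rintro ⟨x, hxw, hx⟩ k hk p ho
    refine hx k hk p (ho.congr ho.lt_length fun i hi => ?_)
    rw [mem_cylinder_iff.1 hxw i hi]
  · exact fun h => ⟨zeroExtend w, zeroExtend_mem_cylinder w, h⟩

variable {D : ℕ → Set ℕ}

theorem eraseShift_eqOn (hS : ∀ n, D n ⊆ S) : EqOn (eraseShift D) shift (avoiding S) := by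
  intro x hx
  funext n
  exact erase_apply_of_not_occurs fun k hk => shift_mem_avoiding hx k (hS _ hk) n

theorem eraseShift_image_avoiding (hS : ∀ n, D n ⊆ S) :
    eraseShift D '' avoiding S = avoiding S := by
  refine Subset.antisymm ?_ fun x hx => ?_
  · rintro _ ⟨x, hx, rfl⟩
    rw [eraseShift_eqOn hS hx]
    exact shift_mem_avoiding hx
  · -- the sequence `0x` is the shift of `00x`, which avoids the patterns
    have h : splice x 0 2 x ∈ avoiding S := splice_mem_avoiding le_rfl hx hx
    refine ⟨shift (splice x 0 2 x), shift_mem_avoiding h, ?_⟩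
    rw [eraseShift_eqOn hS (shift_mem_avoiding h)]
    exact shift_iterate_splice (x := x) (m := 0) (t := 2) (by omega)

theorem eraseShift_iterate_eqOn (hS : ∀ n, D n ⊆ S) (t : ℕ) :
    EqOn ((eraseShift D)^[t]) (shift^[t]) (avoiding S) := by
  induction t with
  | zero => exact fun _ _ => rfl
  | succ t ih =>
    intro x hx
    rw [Function.iterate_succ_apply, Function.iterate_succ_apply, eraseShift_eqOn hS hx,
      ih (shift_mem_avoiding hx)]

theorem isTopologicallyMixingOn_avoiding (hS : ∀ n, D n ⊆ S) :
    IsTopologicallyMixingOn (eraseShift D) (avoiding S) := by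
  rintro U V hU hV ⟨x, hxU, hxA⟩ ⟨y, hyV, hyA⟩
  obtain ⟨m, hm⟩ := exists_cylinder_subset hU hxU
  refine ⟨m + 2, fun n hn => ⟨y, ⟨splice x m n y, ⟨hm _ fun i hi => splice_apply_lt hi,
    splice_mem_avoiding hn hxA hyA⟩, ?_⟩, hyV, hyA⟩⟩
  rw [eraseShift_iterate_eqOn hS n (splice_mem_avoiding hn hxA hyA)]
  exact shift_iterate_splice (by omega)

theorem iInter_range_eraseShift_iterate (hD : Monotone D) :
    ⋂ n : ℕ, (eraseShift D)^[n] '' univ = avoiding (⋃ n, D n) := by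
  refine Subset.antisymm (fun x hx k hk p => ?_) (subset_iInter fun n => ?_)
  · obtain ⟨t, ht⟩ := mem_iUnion.1 hk
    obtain ⟨y, -, rfl⟩ := mem_iInter.1 hx (t + 1)
    exact not_occurs_eraseShift_iterate hD ht
  · have : (eraseShift D)^[n] '' avoiding (⋃ n, D n) = avoiding (⋃ n, D n) := by
      induction n with
      | zero => simp
      | succ n ih =>
        rw [Function.iterate_succ, image_comp,
          eraseShift_image_avoiding (fun n => subset_iUnion D n), ih]
    exact this.symm.subset.trans (image_mono (subset_univ _))

theorem isStronglyAttracting_avoiding (hD : Monotone D) :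
    IsStronglyAttracting (eraseShift D) (avoiding (⋃ n, D n)) :=
  ⟨univ, isOpen_univ, subset_univ _, subset_univ _, (iInter_range_eraseShift_iterate hD).symm⟩

theorem omegaSet_eraseShift_subset (hD : Monotone D) (x : BinSeq) :
    omegaSet (eraseShift D) x ⊆ avoiding (⋃ n, D n) := by
  intro y hy k hk p
  obtain ⟨t, ht⟩ := mem_iUnion.1 hk
  refine (isClopen_setOf_occurs k p).compl.isClosed.mem_of_mapClusterPt hy ?_
  filter_upwards [eventually_gt_atTop t] with n hn
  obtain ⟨s, rfl⟩ : ∃ s, n = s + 1 := ⟨n - 1, by omega⟩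
  exact not_occurs_eraseShift_iterate hD (hD (by omega) ht)

end Avoiding

/-! ### Computability -/

/-- The indices `k ≤ n` that code a pair of a program and an input on which the program is seen to
halt within the bound `n`. The condition `k ≤ n` bounds the length of the patterns that have to be
detected at position `n`. -/
def haltStage (n : ℕ) : Set ℕ :=
  {k | k ≤ n ∧ (Nat.Partrec.Code.evaln n (Denumerable.ofNat (Nat.Partrec.Code × ℕ) k).1
    (Denumerable.ofNat (Nat.Partrec.Code × ℕ) k).2).isSome}

/-- The halting set. -/
def haltSet : Set ℕ := ⋃ n, haltStage n

theorem haltStage_mono : Monotone haltStage := by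
  intro m n hmn k hk
  obtain ⟨a, ha⟩ := Option.isSome_iff_exists.1 hk.2
  exact ⟨hk.1.trans hmn, Option.isSome_iff_exists.2 ⟨a, Nat.Partrec.Code.evaln_mono hmn ha⟩⟩

theorem encode_mem_haltSet {c : Nat.Partrec.Code} {n : ℕ} :
    Encodable.encode (c, n) ∈ haltSet ↔ (c.eval n).Dom := by
  simp only [haltSet, haltStage, mem_iUnion, mem_ofPred_eq, Denumerable.ofNat_encode]
  constructor
  · rintro ⟨t, -, h⟩
    obtain ⟨a, ha⟩ := Option.isSome_iff_exists.1 h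
    exact Part.dom_iff_mem.2 ⟨a, Nat.Partrec.Code.evaln_sound ha⟩
  · intro h
    obtain ⟨a, ha⟩ := Part.dom_iff_mem.1 h
    obtain ⟨t, ht⟩ := Nat.Partrec.Code.evaln_complete.1 ha
    exact ⟨max t (Encodable.encode (c, n)), le_max_right _ _,
      Option.isSome_iff_exists.2 ⟨a, Nat.Partrec.Code.evaln_mono (le_max_left _ _) ht⟩⟩

theorem primrecRel_haltStage : PrimrecRel fun n k => k ∈ haltStage n := by
  have hof : Primrec fun a : ℕ × ℕ => Denumerable.ofNat (Nat.Partrec.Code × ℕ) a.2 :=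
    (Primrec.ofNat (Nat.Partrec.Code × ℕ)).comp Primrec.snd
  refine (Primrec.nat_le.comp Primrec.snd Primrec.fst).and ?_
  have h : Primrec fun a : ℕ × ℕ =>
      (Nat.Partrec.Code.evaln a.1 (Denumerable.ofNat (Nat.Partrec.Code × ℕ) a.2).1
        (Denumerable.ofNat (Nat.Partrec.Code × ℕ) a.2).2).isSome :=
    Primrec.option_isSome.comp (Nat.Partrec.Code.primrec_evaln.comp
      ((Primrec.fst.pair (Primrec.fst.comp hof)).pair (Primrec.snd.comp hof)))
  exact Primrec.eq.comp h (Primrec.const true)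

theorem primrecRel_exists_lt {α : Type*} [Primcodable α] {R : ℕ → α → Prop} (h : PrimrecRel R) :
    PrimrecRel fun n a => ∃ x < n, R x a :=
  PrimrecPred.of_eq (h.exists_mem_list.comp (Primrec.list_range.comp Primrec.fst) Primrec.snd)
    (by simp)

theorem primrecRel_forall_lt {α : Type*} [Primcodable α] {R : ℕ → α → Prop} (h : PrimrecRel R) :
    PrimrecRel fun n a => ∀ x < n, R x a :=
  PrimrecPred.of_eq (h.forall_mem_list.comp (Primrec.list_range.comp Primrec.fst) Primrec.snd)
    (by simp)

theorem primrec_zeroExtend : Primrec₂ zeroExtend := Primrec.list_getD false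

theorem primrecPred_occurs {α : Type*} [Primcodable α] {k p : α → ℕ} {w : α → List Bool}
    (hk : Primrec k) (hw : Primrec w) (hp : Primrec p) :
    PrimrecPred fun a => Occurs (k a) (zeroExtend (w a)) (p a) := by
  have hdouble : ∀ {β : Type _} [Primcodable β] {f : β → ℕ}, Primrec f →
      Primrec fun b => 2 * f b := fun hf => Primrec.nat_mul.comp (Primrec.const 2) hf
  have h1 : PrimrecPred fun a => zeroExtend (w a) (p a) = true :=
    Primrec.eq.comp (primrec_zeroExtend.comp hw hp) (Primrec.const true)
  have h2 : PrimrecPred fun a => zeroExtend (w a) (p a + 2 * k a + 2) = true :=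
    Primrec.eq.comp (primrec_zeroExtend.comp hw (Primrec.nat_add.comp
      (Primrec.nat_add.comp hp (hdouble hk)) (Primrec.const 2))) (Primrec.const true)
  have h3 : PrimrecRel fun (i : ℕ) (a : α) => zeroExtend (w a) (p a + 1 + 2 * i) = true :=
    Primrec.eq.comp (primrec_zeroExtend.comp (hw.comp Primrec.snd) (Primrec.nat_add.comp
      (Primrec.succ.comp (hp.comp Primrec.snd)) (hdouble Primrec.fst))) (Primrec.const true)
  have h4 : PrimrecRel fun (n : ℕ) (a : α) => ∀ i < n, zeroExtend (w a) (p a + 1 + 2 * i) = true :=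
    primrecRel_forall_lt h3
  exact h1.and (h2.and (h4.comp (Primrec.succ.comp hk) Primrec.id))

theorem eraseShift_apply_eq_true {D : ℕ → Set ℕ} {x : BinSeq} {n : ℕ} :
    eraseShift D x n = true ↔ x (n + 1) = true ∧ ¬ ∃ k ∈ D n, Occurs k x (n + 1) := by
  simp only [eraseShift, erase, Bool.and_eq_true, Bool.not_eq_true', decide_eq_false_iff_not,
    occurs_shift_iff]
  rfl

open Classical in
theorem isComputableMap_eraseShift : IsComputableMap (eraseShift haltStage) := by
  -- a pattern occurring at position `n + 1` with index at most `n` ends at position `3 n + 3`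
  refine ⟨fun n => 3 * n + 3,
    fun w => eraseShift haltStage (zeroExtend w) ((w.length - 4) / 3), ?_, ?_, fun x n => ?_⟩
  · exact (Primrec.nat_add.comp (Primrec.nat_mul.comp (Primrec.const 3) Primrec.id)
      (Primrec.const 3)).to_comp
  · have hn : Primrec fun w : List Bool => (w.length - 4) / 3 :=
      Primrec.nat_div.comp (Primrec.nat_sub.comp Primrec.list_length (Primrec.const 4))
        (Primrec.const 3)
    have h1 : PrimrecPred fun w : List Bool =>
        zeroExtend w ((w.length - 4) / 3 + 1) = true :=
      Primrec.eq.comp (primrec_zeroExtend.comp Primrec.id (Primrec.succ.comp hn))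
        (Primrec.const true)
    have h2 : PrimrecRel fun (k : ℕ) (w : List Bool) => k ∈ haltStage ((w.length - 4) / 3) ∧
        Occurs k (zeroExtend w) ((w.length - 4) / 3 + 1) :=
      (primrecRel_haltStage.comp (hn.comp Primrec.snd) Primrec.fst).and
        (primrecPred_occurs Primrec.fst Primrec.snd (Primrec.succ.comp (hn.comp Primrec.snd)))
    have h3 : PrimrecRel fun (n : ℕ) (w : List Bool) => ∃ k < n,
        k ∈ haltStage ((w.length - 4) / 3) ∧
          Occurs k (zeroExtend w) ((w.length - 4) / 3 + 1) := primrecRel_exists_lt h2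
    have h4 := h1.and (h3.comp (Primrec.succ.comp hn) Primrec.id).not
    refine Primrec.to_comp (h4.decide.of_eq fun w => ?_)
    rw [Bool.eq_iff_iff, decide_eq_true_iff, eraseShift_apply_eq_true]
    refine and_congr Iff.rfl (not_congr ⟨?_, ?_⟩)
    · rintro ⟨k, -, h⟩; exact ⟨k, h⟩
    · rintro ⟨k, h⟩; exact ⟨k, Nat.lt_succ_of_le h.1.1, h⟩
  · have hlen : ((prefixWord x (3 * n + 3 + 1)).length - 4) / 3 = n := by
      rw [prefixWord_length]; omega
    simp only [hlen]
    rw [Bool.eq_iff_iff, eraseShift_apply_eq_true, eraseShift_apply_eq_true,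
      zeroExtend_prefixWord (by omega)]
    refine and_congr Iff.rfl (not_congr (exists_congr fun k => and_congr_right fun hk => ?_))
    have hkn : k ≤ n := hk.1
    exact ⟨fun h => h.congr (n := 3 * n + 3 + 1) (by omega)
      fun i hi => (zeroExtend_prefixWord hi).symm,
      fun h => h.congr (n := 3 * n + 3 + 1) (by omega) fun i hi => zeroExtend_prefixWord hi⟩

theorem continuous_of_isComputableMap {T : BinSeq → BinSeq} (hT : IsComputableMap T) :
    Continuous T := by
  obtain ⟨α, β, -, -, h⟩ := hT
  refine continuous_pi fun n => continuous_iff_continuousAt.2 fun x => ?_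
  refine (continuousAt_const (y := T x n)).congr ?_
  have hmem : cylinder (prefixWord x (α n + 1)) ∈ 𝓝 x :=
    (isClopen_cylinder _).isOpen.mem_nhds (mem_cylinder_prefixWord.2 fun _ _ => rfl)
  filter_upwards [hmem] with y hy
  have : prefixWord y (α n + 1) = prefixWord x (α n + 1) := by
    have := hy
    rwa [_root_.cylinder, mem_ofPred_eq, prefixWord_length] at this
  rw [h, h, this]

open Classical in
theorem isPiOne_avoiding_haltSet : IsPiOne (avoiding haltSet) := by
  refine ⟨isClosed_avoiding _, fun w j => decide (¬ ∃ k < j + 1, k ∈ haltStage j ∧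
    ∃ p < w.length, Occurs k (zeroExtend w) p), ?_, fun w => ?_⟩
  · have h1 : PrimrecRel fun (p : ℕ) (a : List Bool × ℕ) => Occurs a.2 (zeroExtend a.1) p :=
      primrecPred_occurs (Primrec.snd.comp Primrec.snd) (Primrec.fst.comp Primrec.snd) Primrec.fst
    have h1' : PrimrecRel fun (n : ℕ) (a : List Bool × ℕ) =>
        ∃ p < n, Occurs a.2 (zeroExtend a.1) p := primrecRel_exists_lt h1
    have h2 : PrimrecPred fun a : List Bool × ℕ =>
        ∃ p < a.1.length, Occurs a.2 (zeroExtend a.1) p :=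
      h1'.comp (Primrec.list_length.comp Primrec.fst) Primrec.id
    have h3 : PrimrecRel fun (k : ℕ) (a : List Bool × ℕ) => k ∈ haltStage a.2 ∧
        ∃ p < a.1.length, Occurs k (zeroExtend a.1) p :=
      (primrecRel_haltStage.comp (Primrec.snd.comp Primrec.snd) Primrec.fst).and
        (h2.comp ((Primrec.fst.comp Primrec.snd).pair Primrec.fst))
    have h4 : PrimrecRel fun (n : ℕ) (a : List Bool × ℕ) => ∃ k < n, k ∈ haltStage a.2 ∧
        ∃ p < a.1.length, Occurs k (zeroExtend a.1) p := primrecRel_exists_lt h3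
    exact (h4.comp (Primrec.succ.comp Primrec.snd)
      Primrec.id).not.decide.to_comp
  · rw [meetsCylinder_avoiding_iff]
    simp only [decide_eq_true_iff]
    constructor
    · rintro h j ⟨k, -, hk, p, -, ho⟩
      exact h k (mem_iUnion.2 ⟨j, hk⟩) p ho
    · intro h k hk p ho
      obtain ⟨j, hj⟩ := mem_iUnion.1 hk
      have := ho.lt_length
      exact h j ⟨k, Nat.lt_succ_of_le hj.1, hj, p, by omega, ho⟩

/-- The word `11(01)ᵏ1`. -/
def patternWord (k : ℕ) : List Bool :=
  (List.range (2 * k + 3)).map fun i => decide (i = 0 ∨ i = 2 * k + 2 ∨ i % 2 = 1)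

theorem zeroExtend_patternWord {k i : ℕ} :
    zeroExtend (patternWord k) i = true ↔ i = 0 ∨ i = 2 * k + 2 ∨ (i % 2 = 1 ∧ i < 2 * k + 2) := by
  by_cases hi : i < 2 * k + 3
  · simp [zeroExtend, patternWord, hi]
    omega
  · simp [zeroExtend, patternWord, hi]
    omega

/-- The words `11(01)ᵏ1` are independent of each other: the pairs `11` at the two ends of the word
determine its length. -/
theorem occurs_patternWord_iff {j k p : ℕ} :
    Occurs j (zeroExtend (patternWord k)) p ↔ j = k ∧ p = 0 := by
  unfold Occurs
  simp only [zeroExtend_patternWord]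
  constructor
  · rintro ⟨h1, h2, h3⟩
    have h4 := h3 0 (by omega)
    have h5 := h3 j (by omega)
    omega
  · rintro ⟨rfl, rfl⟩
    refine ⟨?_, ?_, fun i hi => ?_⟩ <;> omega

theorem meetsCylinder_patternWord {S : Set ℕ} {k : ℕ} :
    MeetsCylinder (avoiding S) (patternWord k) ↔ k ∉ S := by
  rw [meetsCylinder_avoiding_iff]
  simp only [occurs_patternWord_iff]
  exact ⟨fun h hk => h k hk 0 ⟨rfl, rfl⟩, fun h j hj p hp => h (hp.1 ▸ hj)⟩

theorem primrec_patternWord : Primrec patternWord := by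
  have h : PrimrecPred fun a : ℕ × ℕ => a.2 = 0 ∨ a.2 = 2 * a.1 + 2 ∨ a.2 % 2 = 1 :=
    (Primrec.eq.comp Primrec.snd (Primrec.const 0)).or
      ((Primrec.eq.comp Primrec.snd (Primrec.nat_add.comp
        (Primrec.nat_mul.comp (Primrec.const 2) Primrec.fst) (Primrec.const 2))).or
        (Primrec.eq.comp (Primrec.nat_mod.comp Primrec.snd (Primrec.const 2)) (Primrec.const 1)))
  exact Primrec.list_map (Primrec.list_range.comp (Primrec.nat_add.comp
    (Primrec.nat_mul.comp (Primrec.const 2) Primrec.id) (Primrec.const 3))) h.decide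

theorem partrec_search {α : Type*} [Primcodable α] {g : α → ℕ → Bool} (hg : Computable₂ g) :
    Partrec fun a => Nat.rfind (g a : ℕ →. Bool) :=
  Partrec.rfind hg.partrec₂

theorem search_dom {g : ℕ → Bool} :
    (Nat.rfind (g : ℕ →. Bool)).Dom ↔ ∃ j, g j = true := by
  rw [Nat.rfind_dom]
  constructor
  · rintro ⟨j, hj, -⟩; exact ⟨j, (Part.mem_some_iff.1 hj).symm⟩
  · rintro ⟨j, hj⟩; exact ⟨j, Part.mem_some_iff.2 hj.symm, fun _ => trivial⟩

theorem isPiOneComplete_avoiding_haltSet : IsPiOneComplete (avoiding haltSet) := by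
  refine ⟨isPiOne_avoiding_haltSet, ?_⟩
  rintro K' ⟨-, f, hf, hfK⟩
  -- the program that searches for a witness that a ball is disjoint from `K'`
  have hsearch := partrec_search (g := fun w j => !f w j) (Primrec.not.to_comp.comp hf)
  obtain ⟨c, hc⟩ := Nat.Partrec.Code.exists_code.1 hsearch
  refine ⟨fun w => patternWord (Encodable.encode (c, Encodable.encode w)), ?_, fun w => ?_⟩
  · exact (primrec_patternWord.comp (Primrec.encode.comp
      ((Primrec.const c).pair Primrec.encode))).to_comp
  · rw [hfK, meetsCylinder_patternWord, encode_mem_haltSet, hc]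
    simp only [Encodable.encodek, Part.coe_some, Part.bind_some]
    change _ ↔ ¬ (Nat.rfind ((fun j => !f w j : ℕ → Bool) : ℕ →. Bool)).Dom
    rw [search_dom]
    simp

theorem not_rePred_meetsCylinder_avoiding_haltSet :
    ¬ REPred (MeetsCylinder (avoiding haltSet)) := by
  intro h
  refine ComputablePred.halting_problem_not_re 0 ?_
  -- the word attached to `(c, 0)` meets the set exactly when the program `c` diverges on `0`
  have hr : Computable fun c : Nat.Partrec.Code => patternWord (Encodable.encode (c, 0)) :=
    (primrec_patternWord.comp (Primrec.encode.comp (Primrec.id.pair (Primrec.const 0)))).to_comp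
  refine REPred.of_eq (Partrec.comp h hr : REPred fun c : Nat.Partrec.Code =>
    MeetsCylinder (avoiding haltSet) (patternWord (Encodable.encode (c, 0)))) fun c => ?_
  rw [meetsCylinder_patternWord, encode_mem_haltSet]

/-- The balls of positive measure can be enumerated when the measure is computable. -/
theorem IsComputableMeasure.rePred_pos {μ : ProbabilityMeasure BinSeq}
    (hμ : IsComputableMeasure μ) :
    REPred fun w => 0 < (μ : Measure BinSeq).real (cylinder w) := by
  obtain ⟨f, hf, hlub⟩ := hμ
  have hg : Computable₂ fun (w : List Bool) (k : ℕ) => decide (0 < (f [w] k).1) := by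
    have h1 : Computable fun a : List Bool × ℕ => (f [a.1] a.2).1 :=
      Computable.fst.comp (hf.comp
        (Computable.list_cons.comp Computable.fst (Computable.const [])) Computable.snd)
    have h2 : Primrec fun n : ℕ => decide (0 < n) :=
      (Primrec.nat_lt.comp (Primrec.const 0) Primrec.id).decide
    exact h2.to_comp.comp h1
  refine (partrec_search hg).dom_re.of_eq fun w => ?_
  rw [search_dom]
  have hL := hlub [w]
  simp only [List.mem_singleton, iUnion_iUnion_eq_left] at hL
  rw [lt_isLUB_iff hL]
  simp only [mem_range, exists_exists_eq_and, decide_eq_true_iff]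
  refine exists_congr fun k => ?_
  constructor
  · intro h; have : (0 : ℝ) < (f [w] k).1 := by exact_mod_cast h
    positivity
  · intro h
    by_contra h0
    rw [Nat.eq_zero_of_not_pos h0] at h
    simp at h

/-! ### Topological attraction -/

theorem IsCompact.omegaSet_inter_nonempty {X : Type*} [TopologicalSpace X] {T : X → X}
    {K : Set X} (hK : IsCompact K) {x : X} (h : ∃ᶠ n in atTop, T^[n] x ∈ K) :
    (omegaSet T x ∩ K).Nonempty := by
  obtain ⟨y, hyK, hy⟩ := hK.exists_mapClusterPt_of_frequently h
  exact ⟨y, hy, hyK⟩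

/-- If `A'` is a closed set that does not contain `A`, the orbits in the realm of `A'` eventually
leave some cylinder around a point of `A`. -/
theorem exists_cylinder_of_ssubset {A A' : Set BinSeq} (hA' : IsClosed A') (h : A' ⊂ A) :
    ∃ y ∈ A, ∃ n, ∀ (T : BinSeq → BinSeq), ∀ x ∈ realm T A',
      ∀ᶠ t in atTop, T^[t] x ∉ cylinder (prefixWord y n) := by
  obtain ⟨y, hyA, hyA'⟩ := exists_of_ssubset h
  obtain ⟨n, hn⟩ := exists_cylinder_subset hA'.isOpen_compl hyA'
  refine ⟨y, hyA, n, fun T x hx => ?_⟩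
  by_contra hf
  obtain ⟨z, hz, hzc⟩ := (isClopen_cylinder (prefixWord y n)).isClosed.isCompact
    |>.omegaSet_inter_nonempty (T := T) (x := x)
      (Filter.not_eventually.1 hf |>.mono fun _ h => not_not.1 h)
  exact hn z (mem_cylinder_prefixWord.1 hzc) (hx hz)

section Attractor

variable {D : ℕ → Set ℕ}

theorem isTopologicalAttractor_avoiding (hD : Monotone D) (hc : Continuous (eraseShift D)) :
    IsTopologicalAttractor (eraseShift D) (avoiding (⋃ n, D n)) := by
  refine ⟨isClosed_avoiding _, ?_, fun A' hA' hss => ?_⟩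
  · exact mem_of_superset univ_mem fun x _ => omegaSet_eraseShift_subset hD x
  · obtain ⟨y, hyA, n, hn⟩ := exists_cylinder_of_ssubset hA' hss
    set G : ℕ → Set BinSeq :=
      fun N => ⋃ t ≥ N, (eraseShift D)^[t] ⁻¹' cylinder (prefixWord y n) with hG
    have hopen : ∀ N, IsOpen (G N) := fun N => isOpen_biUnion fun t _ =>
      (isClopen_cylinder _).isOpen.preimage (hc.iterate t)
    have hdense : ∀ N, Dense (G N) := by
      intro N
      rw [dense_iff_inter_open]
      rintro U hU ⟨x, hx⟩
      obtain ⟨m, hm⟩ := exists_cylinder_subset hU hx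
      refine ⟨splice x m (m + 2 + N) y, hm _ fun i hi => splice_apply_lt hi, ?_⟩
      simp only [hG, mem_iUnion, mem_preimage]
      refine ⟨m + 2 + N, Nat.le_add_left _ _, ?_⟩
      rw [eraseShift_iterate_splice hD (fun n => subset_iUnion D n) (by omega) hyA]
      exact mem_cylinder_prefixWord.2 fun _ _ => rfl
    have hres : ⋂ N, G N ∈ residual BinSeq :=
      countable_iInter_mem.2 fun N => residual_of_dense_open (hopen N) (hdense N)
    refine mem_of_superset hres fun x hx hxr => ?_
    obtain ⟨N, hN⟩ := eventually_atTop.1 (hn _ x hxr)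
    have := mem_iInter.1 hx N
    simp only [hG, mem_iUnion, mem_preimage] at this
    obtain ⟨t, ht, h⟩ := this
    exact hN t ht h

end Attractor

/-! ### Entropy -/

/-- The sequence `0 v₀ 0 v₁ 0 v₂ …`. -/
def interleaveZero (v : ℕ → Bool) : BinSeq := fun i => i % 2 == 1 && v (i / 2)

theorem interleaveZero_mem_avoiding (S : Set ℕ) (v : ℕ → Bool) :
    interleaveZero v ∈ avoiding S := by
  intro k _ p h
  have h1 := h.1
  have h2 := h.2.2 0 (by omega)
  simp only [interleaveZero, Bool.and_eq_true, beq_iff_eq] at h1 h2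
  omega

theorem coverEntropy_pos_of_eqOn_shift {T : BinSeq → BinSeq} {S : Set ℕ}
    (hT : ∀ t, EqOn (T^[t]) (shift^[t]) (avoiding S)) :
    0 < Dynamics.coverEntropy T (avoiding S) := by
  classical
  set U : SetRel BinSeq BinSeq := {q | q.1 0 = q.2 0} with hUdef
  have hU : U ∈ uniformity BinSeq := by
    have h1 : UniformContinuous fun x : BinSeq => x 0 := Pi.uniformContinuous_proj _ 0
    exact h1 (DiscreteUniformity.relId_mem_uniformity Bool)
  refine lt_of_lt_of_le ?_ (Dynamics.netEntropyEntourage_le_coverEntropy T (avoiding S) hU)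
  set u : ℕ → ENNReal := fun n => (Dynamics.netMaxcard T (avoiding S) U n : ENNReal) with hu
  have hmono : Monotone u := fun m n hmn =>
    ENat.toENNReal_mono (Dynamics.netMaxcard_monotone_time T (avoiding S) U hmn)
  have hlow : ∀ m, (2 : ENNReal) ^ m ≤ u (2 * m) := by
    intro m
    let e : (Fin m → Bool) → BinSeq :=
      fun v => interleaveZero fun i => if h : i < m then v ⟨i, h⟩ else false
    have he : ∀ v (i : Fin m), e v (2 * i + 1) = v i := by
      intro v i
      have h1 : (2 * (i : ℕ) + 1) % 2 = 1 := by omega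
      have h2 : (2 * (i : ℕ) + 1) / 2 = i := by omega
      simp [e, interleaveZero, h1, h2]
    have hmem : ∀ v, e v ∈ avoiding S := fun v => interleaveZero_mem_avoiding S _
    have hinj : Function.Injective e := fun v w h => by
      funext i; rw [← he v, ← he w, h]
    have hnet : Dynamics.IsDynNetIn T (avoiding S) U (2 * m)
        ((Finset.univ.image e : Finset BinSeq) : Set BinSeq) := by
      constructor
      · intro x hx
        obtain ⟨v, -, rfl⟩ := Finset.mem_image.1 (Finset.mem_coe.1 hx)
        exact hmem v
      · intro x hx y hy hxy
        obtain ⟨v, -, rfl⟩ := Finset.mem_image.1 (Finset.mem_coe.1 hx)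
        obtain ⟨w, -, rfl⟩ := Finset.mem_image.1 (Finset.mem_coe.1 hy)
        refine Set.disjoint_left.2 fun z hz1 hz2 => hxy ?_
        rw [Dynamics.mem_ball_dynEntourage] at hz1 hz2
        congr 1
        funext i
        have hi : 2 * (i : ℕ) + 1 < 2 * m := by have := i.2; omega
        have h1 : T^[2 * (i : ℕ) + 1] (e v) 0 = T^[2 * (i : ℕ) + 1] z 0 := hz1 _ hi
        have h2 : T^[2 * (i : ℕ) + 1] (e w) 0 = T^[2 * (i : ℕ) + 1] z 0 := hz2 _ hi
        rw [hT _ (hmem _), shift_iterate_apply, zero_add, he] at h1 h2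
        rw [h1, h2]
    have h := hnet.card_le_netMaxcard
    rw [Finset.card_image_of_injective _ hinj] at h
    have h' := ENat.toENNReal_mono h
    simpa using! h'
  have h1 : ENNReal.log 2 ≤ ExpGrowth.expGrowthSup fun m => u (2 * m) := by
    rw [← ExpGrowth.expGrowthSup_pow]
    exact ExpGrowth.expGrowthSup_monotone hlow
  have h2 : (0 : EReal) < ENNReal.log 2 := by
    rw [← ENNReal.log_one]; exact ENNReal.log_strictMono (by norm_num)
  have h3 := hmono.expGrowthSup_comp_mul (m := 2) (by norm_num)
  change ExpGrowth.expGrowthSup (fun m => u (2 * m)) = _ at h3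
  rw [h3] at h1
  by_contra h0
  have h4 : ExpGrowth.expGrowthSup u ≤ 0 := not_lt.1 h0
  exact absurd (h2.trans_le h1) (not_lt.2 (EReal.mul_nonpos_iff.2 (.inl ⟨by positivity, h4⟩)))

/-! ### Cesàro means along sequences of points -/

/-- The Cesàro mean `(c₀ + … + c₍ₙ₋₁₎) / n`. -/
noncomputable def cesaro (c : ℕ → ℝ) (n : ℕ) : ℝ := (n : ℝ)⁻¹ * ∑ i ∈ Finset.range n, c i

theorem cesaro_mono {c d : ℕ → ℝ} (h : ∀ i, c i ≤ d i) (n : ℕ) : cesaro c n ≤ cesaro d n :=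
  mul_le_mul_of_nonneg_left (Finset.sum_le_sum fun i _ => h i) (by positivity)

theorem cesaro_add (c d : ℕ → ℝ) (n : ℕ) :
    cesaro (fun i => c i + d i) n = cesaro c n + cesaro d n := by
  simp [cesaro, Finset.sum_add_distrib, mul_add]

theorem cesaro_sub (c d : ℕ → ℝ) (n : ℕ) :
    cesaro (fun i => c i - d i) n = cesaro c n - cesaro d n := by
  simp [cesaro, Finset.sum_sub_distrib, mul_sub]

theorem cesaro_const_mul (r : ℝ) (c : ℕ → ℝ) (n : ℕ) :
    cesaro (fun i => r * c i) n = r * cesaro c n := by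
  simp only [cesaro, ← Finset.mul_sum]; ring

theorem cesaro_const_le {r : ℝ} (hr : 0 ≤ r) (n : ℕ) : cesaro (fun _ => r) n ≤ r := by
  rcases Nat.eq_zero_or_pos n with rfl | hn
  · simpa [cesaro] using hr
  · have : (n : ℝ) ≠ 0 := by positivity
    simp [cesaro, this]

theorem abs_cesaro_le (c : ℕ → ℝ) (n : ℕ) : |cesaro c n| ≤ cesaro (fun i => |c i|) n := by
  unfold cesaro
  rw [abs_mul, abs_of_nonneg (by positivity : (0 : ℝ) ≤ (n : ℝ)⁻¹)]
  exact mul_le_mul_of_nonneg_left (Finset.abs_sum_le_sum_abs _ _) (by positivity)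

theorem tendsto_cesaro_of_eventually_eq_zero {c : ℕ → ℝ} (h : ∀ᶠ i in atTop, c i = 0) :
    Tendsto (cesaro c) atTop (𝓝 0) :=
  Tendsto.cesaro (tendsto_const_nhds.congr' (h.mono fun _ h => h.symm))

open Classical in
/-- A continuous function takes nearby Cesàro means along two sequences of points if, for each `m`,
the two sequences agree in the first `m` letters at most times. -/
theorem tendsto_cesaro_sub_of_agree {a b : ℕ → BinSeq} (g : C(BinSeq, ℝ))
    (h : ∀ m, Tendsto (cesaro fun i => if ∃ j < m, a i j ≠ b i j then (1 : ℝ) else 0)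
      atTop (𝓝 0)) :
    Tendsto (fun n => cesaro (fun i => g (a i)) n - cesaro (fun i => g (b i)) n) atTop (𝓝 0) := by
  rw [Metric.tendsto_nhds]
  intro ε hε
  have hloc : ∀ x : BinSeq, ∃ n, ∀ y : BinSeq, (∀ i < n, y i = x i) → dist (g y) (g x) < ε / 4 := by
    intro x
    exact exists_cylinder_subset (U := {y | dist (g y) (g x) < ε / 4})
      (isOpen_lt (by fun_prop) continuous_const) (by simp [hε])
  choose N hN using hloc
  obtain ⟨t, -, ht⟩ := (isCompact_univ (X := BinSeq)).elim_nhds_subcover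
    (fun x => cylinder (prefixWord x (N x))) fun x _ =>
      (isClopen_cylinder _).isOpen.mem_nhds (mem_cylinder_prefixWord.2 fun _ _ => rfl)
  -- by compactness, agreement in the first `m` letters makes the values of `g` close everywhere
  set m := t.sup N
  have hunif : ∀ u v : BinSeq, (∀ j < m, u j = v j) → |g u - g v| ≤ ε / 2 := by
    intro u v huv
    obtain ⟨x, hxt, hx⟩ := mem_iUnion₂.1 (ht (mem_univ v))
    rw [mem_cylinder_prefixWord] at hx
    have h1 := hN x v hx
    have h2 := hN x u fun i hi =>
      (huv i (hi.trans_le (Finset.le_sup (f := N) hxt))).trans (hx i hi)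
    rw [← Real.dist_eq]
    have := dist_triangle_right (g u) (g v) (g x)
    linarith
  have hM : ∀ u v : BinSeq, |g u - g v| ≤ 2 * ‖g‖ := fun u v => by
    have h1 := g.norm_coe_le_norm u
    have h2 := g.norm_coe_le_norm v
    rw [Real.norm_eq_abs] at h1 h2
    have := abs_sub (g u) (g v)
    linarith
  have hlim := (h m).const_mul (2 * ‖g‖)
  rw [mul_zero] at hlim
  filter_upwards [hlim.eventually (gt_mem_nhds (half_pos hε))] with n hn
  rw [Real.dist_eq, sub_zero, ← cesaro_sub]
  calc |cesaro (fun i => g (a i) - g (b i)) n|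
      ≤ cesaro (fun i => |g (a i) - g (b i)|) n := abs_cesaro_le _ n
    _ ≤ cesaro (fun i => ε / 2 + 2 * ‖g‖ * if ∃ j < m, a i j ≠ b i j then 1 else 0) n := by
        refine cesaro_mono (fun i => ?_) n
        split_ifs with hi
        · have := hM (a i) (b i)
          linarith
        · push Not at hi
          simpa using hunif _ _ hi
    _ = cesaro (fun _ => ε / 2) n +
          2 * ‖g‖ * cesaro (fun i => if ∃ j < m, a i j ≠ b i j then 1 else 0) n := by
        rw [cesaro_add, cesaro_const_mul]
    _ < ε := by
        have := cesaro_const_le (half_pos hε).le n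
        linarith

theorem tendsto_cesaro_of_dense {X : Type*} [TopologicalSpace X] [CompactSpace X]
    [MeasurableSpace X] [OpensMeasurableSpace X] {μ : Measure X} [IsProbabilityMeasure μ]
    {s : Set C(X, ℝ)} (hs : Dense s) {a : ℕ → X}
    (h : ∀ g ∈ s, Tendsto (cesaro fun i => g (a i)) atTop (𝓝 (∫ x, g x ∂μ))) (g : C(X, ℝ)) :
    Tendsto (cesaro fun i => g (a i)) atTop (𝓝 (∫ x, g x ∂μ)) := by
  rw [Metric.tendsto_nhds]
  intro ε hε
  obtain ⟨f, hfs, hf⟩ := hs.exists_dist_lt g (by positivity : 0 < ε / 4)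
  have hpt : ∀ x, |g x - f x| ≤ ε / 4 := fun x => by
    rw [← Real.dist_eq]; exact (ContinuousMap.dist_apply_le_dist x).trans hf.le
  have hint : ∀ g : C(X, ℝ), Integrable g μ := fun g =>
    Integrable.of_bound g.continuous.measurable.aestronglyMeasurable ‖g‖
      (Eventually.of_forall g.norm_coe_le_norm)
  have h1 : |∫ x, g x ∂μ - ∫ x, f x ∂μ| ≤ ε / 4 := by
    rw [← integral_sub (hint g) (hint f)]
    have := norm_integral_le_of_norm_le_const (μ := μ) (f := fun x => g x - f x)
      (Eventually.of_forall hpt)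
    simpa using this
  filter_upwards [(Metric.tendsto_nhds.1 (h f hfs)) (ε / 4) (by positivity)] with n hn
  have h2 : |cesaro (fun i => g (a i)) n - cesaro (fun i => f (a i)) n| ≤ ε / 4 := by
    rw [← cesaro_sub]
    exact (abs_cesaro_le _ n).trans ((cesaro_mono (fun i => hpt (a i)) n).trans
      (cesaro_const_le (by positivity) n))
  rw [Real.dist_eq] at hn ⊢
  rw [abs_lt] at hn ⊢
  rw [abs_le] at h1 h2
  constructor <;> linarith [hn.1, hn.2, h1.1, h1.2, h2.1, h2.2]

theorem integral_empiricalMeasure {X : Type*} [TopologicalSpace X] [MeasurableSpace X]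
    [OpensMeasurableSpace X] (T : X → X) (x : X) (n : ℕ) {g : X → ℝ} (hg : StronglyMeasurable g) :
    ∫ y, g y ∂(empiricalMeasure T x n : Measure X) = cesaro (fun i => g (T^[i] x)) n := by
  have hint : ∀ i ∈ Finset.range n,
      Integrable g ((diracProba (T^[i] x)).toFiniteMeasure : Measure X) := fun i _ =>
    integrable_dirac' hg (by simp)
  rw [empiricalMeasure, FiniteMeasure.toMeasure_smul, FiniteMeasure.toMeasure_sum]
  rw [integral_smul_nnreal_measure, integral_finsetSum_measure hint, cesaro]
  rw [NNReal.smul_def, smul_eq_mul]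
  simp only [NNReal.coe_inv, NNReal.coe_natCast]
  congr 1
  exact Finset.sum_congr rfl fun i _ => integral_dirac' g _ hg

theorem tendsto_empiricalMeasure_iff {X : Type*} [TopologicalSpace X] [CompactSpace X]
    [MeasurableSpace X] [OpensMeasurableSpace X] {T : X → X} {x : X}
    {μ : ProbabilityMeasure X} :
    Tendsto (empiricalMeasure T x) atTop (𝓝 μ.toFiniteMeasure) ↔
      ∀ g : C(X, ℝ), Tendsto (cesaro fun i => g (T^[i] x)) atTop
        (𝓝 (∫ y, g y ∂(μ : Measure X))) := by
  rw [FiniteMeasure.tendsto_iff_forall_integral_tendsto]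
  have key : ∀ (g : C(X, ℝ)) n, ∫ y, g y ∂(empiricalMeasure T x n : Measure X) =
      cesaro (fun i => g (T^[i] x)) n := fun g n =>
    integral_empiricalMeasure T x n g.continuous.measurable.stronglyMeasurable
  constructor
  · intro h g
    have := h (BoundedContinuousFunction.mkOfCompact g)
    simp only [BoundedContinuousFunction.mkOfCompact_apply, key] at this
    exact this
  · intro h g
    have := h g.toContinuousMap
    refine this.congr fun n => ?_
    exact (key g.toContinuousMap n).symm

/-! ### The physical measure -/

theorem measurable_erase (D : ℕ → Set ℕ) : Measurable (erase D) := by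
  refine measurable_pi_iff.2 fun n => measurable_to_bool ?_
  have : (fun x => erase D x n) ⁻¹' {true} =
      {x | x n = true} ∩ (⋃ k ∈ D n, {x | Occurs k x n})ᶜ := by
    ext x
    simp [erase]
  rw [this]
  refine MeasurableSet.inter ?_ (MeasurableSet.compl ?_)
  · exact (isClopen_letter n true).isOpen.measurableSet
  · exact MeasurableSet.biUnion (to_countable _) fun k _ =>
      (isClopen_setOf_occurs k n).isOpen.measurableSet

theorem continuous_shift : Continuous shift :=
  continuous_pi fun n => continuous_apply (n + 1)

/-- The image of `lam` under the erasure of all patterns with index in `S`. -/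
noncomputable def erasedMeasure (S : Set ℕ) (lam : Measure BinSeq) [IsProbabilityMeasure lam] :
    ProbabilityMeasure BinSeq :=
  ⟨lam.map (erase fun _ => S), Measure.isProbabilityMeasure_map (measurable_erase _).aemeasurable⟩

section Physical

variable {lam : Measure BinSeq} [IsProbabilityMeasure lam] {S : Set ℕ} {D : ℕ → Set ℕ}

theorem coe_erasedMeasure :
    (erasedMeasure S lam : Measure BinSeq) = lam.map (erase fun _ => S) := rfl

theorem ae_mem_avoiding_erasedMeasure :
    ∀ᵐ x ∂(erasedMeasure S lam : Measure BinSeq), x ∈ avoiding S := by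
  rw [coe_erasedMeasure, ae_map_iff (p := fun x => x ∈ avoiding S)
    (measurable_erase _).aemeasurable (isClosed_avoiding S).measurableSet]
  exact Eventually.of_forall (erase_const_mem_avoiding S)

theorem measurePreserving_shift_erasedMeasure (hlam : Ergodic shift lam) :
    MeasurePreserving shift (erasedMeasure S lam : Measure BinSeq)
      (erasedMeasure S lam : Measure BinSeq) := by
  refine ⟨continuous_shift.measurable, ?_⟩
  rw [coe_erasedMeasure, Measure.map_map continuous_shift.measurable (measurable_erase _)]
  have : shift ∘ erase (fun _ => S) = erase (fun _ => S) ∘ shift := by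
    funext x n
    exact (erase_shift_apply n).symm
  rw [this, ← Measure.map_map (measurable_erase _) continuous_shift.measurable,
    hlam.toMeasurePreserving.map_eq]

theorem measurePreserving_eraseShift_erasedMeasure (hlam : Ergodic shift lam)
    (hS : ∀ n, D n ⊆ S) :
    MeasurePreserving (eraseShift D) (erasedMeasure S lam : Measure BinSeq)
      (erasedMeasure S lam : Measure BinSeq) := by
  have h := measurePreserving_shift_erasedMeasure (S := S) hlam
  refine ⟨(measurable_erase D).comp continuous_shift.measurable, ?_⟩
  refine Eq.trans (Measure.map_congr ?_) h.map_eq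
  filter_upwards [ae_mem_avoiding_erasedMeasure] with x hx using eraseShift_eqOn hS hx

/-- A word that can be completed in `avoiding S` survives the erasure when `00` follows it. -/
theorem erasedMeasure_cylinder_pos [lam.IsOpenPosMeasure] {y : BinSeq} (hy : y ∈ avoiding S)
    (n : ℕ) : 0 < (erasedMeasure S lam : Measure BinSeq) (cylinder (prefixWord y n)) := by
  rw [coe_erasedMeasure, Measure.map_apply (measurable_erase _)
    (isClopen_cylinder _).isOpen.measurableSet]
  -- the prefix of `y` followed by `00` is a cylinder whose image lies in that of the prefix
  set z := splice y n (n + 2) fun _ => false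
  refine lt_of_lt_of_le ((isClopen_cylinder (prefixWord z (n + 2))).isOpen.measure_pos lam
    ⟨z, mem_cylinder_prefixWord.2 fun _ _ => rfl⟩) (measure_mono fun x hx => ?_)
  rw [mem_cylinder_prefixWord] at hx
  have hxs : x = splice y n (n + 2) fun i => x (i + (n + 2)) := by
    funext i
    by_cases hi : i < n + 2
    · rw [hx i hi]
      simp [z, splice, hi]
    · simp [splice, hi, show ¬ i < n by omega, Nat.sub_add_cancel (not_lt.1 hi)]
  refine mem_cylinder_prefixWord.2 fun i hi => ?_
  rw [erase_apply_of_not_occurs]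
  · rw [hxs, splice_apply_lt hi]
  · intro k hk ho
    rw [hxs] at ho
    rcases ho.of_splice le_rfl with h | h
    · exact hy k hk _ h.2
    · omega

theorem support_erasedMeasure [lam.IsOpenPosMeasure] :
    (erasedMeasure S lam : Measure BinSeq).support = avoiding S := by
  refine Subset.antisymm (Measure.support_subset_of_isClosed (isClosed_avoiding S)
    ae_mem_avoiding_erasedMeasure) fun y hy => ?_
  rw [Measure.mem_support_iff_forall]
  intro U hU
  obtain ⟨V, hVU, hV, hyV⟩ := mem_nhds_iff.1 hU
  obtain ⟨n, hn⟩ := exists_cylinder_subset hV hyV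
  exact (erasedMeasure_cylinder_pos hy n).trans_le
    (measure_mono fun z hz => hVU (hn z (mem_cylinder_prefixWord.1 hz)))

/-! ### Rare patterns -/

/-- Almost every sequence contains `00` infinitely often. -/
theorem ae_exists_zero_zero [lam.IsOpenPosMeasure] (hlam : Ergodic shift lam) :
    ∀ᵐ x ∂lam, ∀ p, ∃ i ≥ p, x i = false ∧ x (i + 1) = false := by
  set N : Set BinSeq := {x | ∀ i, ¬ (x i = false ∧ x (i + 1) = false)} with hN
  set C : Set BinSeq := cylinder [false, false]
  have hC : ∀ x ∈ C, x 0 = false ∧ x 1 = false := fun x hx => by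
    have h := mem_cylinder_iff.1 hx
    exact ⟨h 0 (by simp), h 1 (by simp)⟩
  have hNm : MeasurableSet N := by
    have : N = ⋂ i, ({x : BinSeq | x i = false} ∩ {x | x (i + 1) = false})ᶜ := by
      ext x; simp [hN]
    rw [this]
    have hcl : ∀ i, MeasurableSet {x : BinSeq | x i = false} := fun i =>
      (isClopen_letter i false).isOpen.measurableSet
    exact MeasurableSet.iInter fun i => ((hcl i).inter (hcl (i + 1))).compl
  have hN0 : lam N = 0 := by
    have hsub : N ≤ᵐ[lam] shift ⁻¹' N := Eventually.of_forall fun x hx i => hx (i + 1)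
    rcases hlam.ae_empty_or_univ_of_ae_le_preimage hNm.nullMeasurableSet hsub with h | h
    · exact ae_eq_empty.1 h
    · exfalso
      have hCpos : 0 < lam C := (isClopen_cylinder _).isOpen.measure_pos lam
        ⟨_, zeroExtend_mem_cylinder _⟩
      have : lam Nᶜ = 0 := by rw [← ae_eq_univ]; exact h
      have hsubC : C ⊆ Nᶜ := fun x hx hxN => hxN 0 (hC x hx)
      exact hCpos.ne' (measure_mono_null hsubC this)
  have : ∀ᵐ x ∂lam, ∀ p, x ∉ shift^[p] ⁻¹' N := ae_all_iff.2 fun p =>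
    measure_eq_zero_iff_ae_notMem.1 (by
      rw [(hlam.toMeasurePreserving.iterate p).measure_preimage hNm.nullMeasurableSet, hN0])
  filter_upwards [this] with x hx p
  have := hx p
  simp only [hN, mem_preimage, mem_ofPred_eq, not_forall, not_not, shift_iterate_apply] at this
  obtain ⟨i, hi⟩ := this
  exact ⟨i + p, by omega, hi.1, by rw [show i + p + 1 = i + 1 + p by omega]; exact hi.2⟩

/-- The sequences in which a pattern with index greater than `K` occurs before position `m`. -/
def longPattern (m K : ℕ) : Set BinSeq := {x | ∃ j < m, ∃ k > K, Occurs k x j}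

theorem measurableSet_longPattern (m K : ℕ) : MeasurableSet (longPattern m K) := by
  have : longPattern m K = ⋃ j ∈ Iio m, ⋃ k ∈ Ioi K, {x | Occurs k x j} := by
    ext x; simp [longPattern]
  rw [this]
  exact MeasurableSet.biUnion (to_countable _) fun j _ =>
    MeasurableSet.biUnion (to_countable _) fun k _ =>
      (isClopen_setOf_occurs k j).isOpen.measurableSet

theorem not_occurs_of_zero_zero {x : BinSeq} {k p i : ℕ} (hi : p < i) (hk : i < p + 2 * k)
    (h0 : x i = false) (h1 : x (i + 1) = false) : ¬ Occurs k x p := by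
  rintro ⟨-, -, h⟩
  rcases Nat.even_or_odd' (i - p) with ⟨c, hc | hc⟩
  · have := h c (by omega)
    rw [show p + 1 + 2 * c = i + 1 by omega, h1] at this
    exact Bool.false_ne_true this
  · have := h c (by omega)
    rw [show p + 1 + 2 * c = i by omega, h0] at this
    exact Bool.false_ne_true this

theorem tendsto_measure_longPattern [lam.IsOpenPosMeasure] (hlam : Ergodic shift lam) (m : ℕ) :
    Tendsto (fun K => lam.real (longPattern m K)) atTop (𝓝 0) := by
  have hanti : Antitone (longPattern m) := fun K L hKL x ⟨j, hj, k, hk, ho⟩ =>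
    ⟨j, hj, k, lt_of_le_of_lt hKL hk, ho⟩
  have h := tendsto_measure_iInter_atTop (μ := lam)
    (fun K => (measurableSet_longPattern m K).nullMeasurableSet) hanti ⟨0, measure_ne_top _ _⟩
  have h0 : lam (⋂ K, longPattern m K) = 0 := by
    refine measure_mono_null ?_ (ae_iff.1 (ae_exists_zero_zero hlam))
    intro x hx hall
    obtain ⟨i, hi, h0, h1⟩ := hall m
    obtain ⟨j, hj, k, hk, ho⟩ := mem_iInter.1 hx i
    exact not_occurs_of_zero_zero (by omega) (by omega) h0 h1 ho
  rw [h0] at h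
  exact (ENNReal.tendsto_toReal ENNReal.zero_ne_top).comp h

theorem exists_stage (hD : Monotone D) (K : ℕ) : ∃ N, ∀ k ≤ K, k ∈ ⋃ n, D n → k ∈ D N := by
  have : ∀ k, ∃ N, k ∈ ⋃ n, D n → k ∈ D N := fun k => by
    by_cases hk : k ∈ ⋃ n, D n
    · obtain ⟨N, hN⟩ := mem_iUnion.1 hk
      exact ⟨N, fun _ => hN⟩
    · exact ⟨0, fun h => absurd h hk⟩
  choose f hf using this
  exact ⟨(Finset.range (K + 1)).sup f, fun k hk hkS =>
    hD (Finset.le_sup (Finset.mem_range.2 (Nat.lt_succ_of_le hk))) (hf k hkS)⟩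

/-- At late times, the orbit of `x` under `eraseShift D` can differ from that of the erased
sequence only near a pattern that is listed late, hence is long. -/
theorem shift_iterate_mem_longPattern (hD : Monotone D) {K N : ℕ}
    (hN : ∀ k ≤ K, k ∈ ⋃ n, D n → k ∈ D N) {x : BinSeq} {m i : ℕ} (hi : N < i)
    (h : ∃ j < m, (eraseShift D)^[i] x j ≠ erase (fun _ => ⋃ n, D n) (shift^[i] x) j) :
    shift^[i] x ∈ longPattern m K := by
  obtain ⟨j, hj, hne⟩ := h
  by_contra hlong
  refine hne ?_
  rw [eraseShift_iterate_apply hD (by omega), erase_const_shift_iterate,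
    show j + i = j + (i - 1) + 1 by omega, ← erase_shift_apply]
  refine erase_congr fun k ho => ⟨fun hk => mem_iUnion.2 ⟨_, hk⟩, fun hk => ?_⟩
  by_cases hkK : k ≤ K
  · exact hD (by omega : N ≤ j + (i - 1)) (hN k hkK hk)
  · refine absurd ⟨j, hj, k, not_le.1 hkK, ?_⟩ hlong
    rw [occurs_shift_iterate_iff, show j + i = j + (i - 1) + 1 by omega]
    exact occurs_shift_iff.1 ho

open Classical in
/-- The disagreement between the two orbits has density zero: by the ergodic theorem its upper
density is at most the measure of `longPattern m K`, for each `K`. -/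
theorem ae_tendsto_cesaro_disagreement [lam.IsOpenPosMeasure] (hlam : Ergodic shift lam)
    (hD : Monotone D) :
    ∀ᵐ x ∂lam, ∀ m, Tendsto (cesaro fun i =>
      if ∃ j < m, (eraseShift D)^[i] x j ≠ erase (fun _ => ⋃ n, D n) (shift^[i] x) j
        then (1 : ℝ) else 0) atTop (𝓝 0) := by
  have hb : ∀ᵐ x ∂lam, ∀ m K, Tendsto (fun n => birkhoffAverage ℝ shift
      ((longPattern m K).indicator fun _ => (1 : ℝ)) n x) atTop
      (𝓝 (lam.real (longPattern m K))) := by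
    refine ae_all_iff.2 fun m => ae_all_iff.2 fun K => ?_
    have hm := measurableSet_longPattern m K
    have := ae_tendsto_birkhoffAverage hlam
      (f := (longPattern m K).indicator fun _ => (1 : ℝ)) (measurable_const.indicator hm)
      ((integrable_const 1).indicator hm)
    simpa [integral_indicator hm] using this
  filter_upwards [hb] with x hx m
  rw [Metric.tendsto_nhds]
  intro ε hε
  obtain ⟨K, hK⟩ := ((tendsto_measure_longPattern hlam m).eventually (gt_mem_nhds hε)).exists
  obtain ⟨N, hN⟩ := exists_stage hD K
  have h0 : Tendsto (cesaro fun i => if i ≤ N then (1 : ℝ) else 0) atTop (𝓝 0) := by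
    refine tendsto_cesaro_of_eventually_eq_zero ?_
    filter_upwards [eventually_gt_atTop N] with i hi
    rw [if_neg (by omega)]
  have hsum := h0.add (hx m K)
  rw [zero_add] at hsum
  filter_upwards [hsum.eventually (gt_mem_nhds hK)] with n hn
  have hnonneg : 0 ≤ cesaro (fun i =>
      if ∃ j < m, (eraseShift D)^[i] x j ≠ erase (fun _ => ⋃ n, D n) (shift^[i] x) j
        then (1 : ℝ) else 0) n := by
    refine mul_nonneg (by positivity) (Finset.sum_nonneg fun i _ => ?_)
    split_ifs <;> norm_num
  rw [Real.dist_eq, sub_zero, abs_of_nonneg hnonneg]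
  refine lt_of_le_of_lt (le_trans (cesaro_mono (d := fun i => (if i ≤ N then (1 : ℝ) else 0) +
    (longPattern m K).indicator (fun _ => (1 : ℝ)) (shift^[i] x)) (fun i => ?_) n) ?_) hn
  · by_cases hiN : i ≤ N
    · have : 0 ≤ (longPattern m K).indicator (fun _ => (1 : ℝ)) (shift^[i] x) :=
        indicator_nonneg (fun _ _ => zero_le_one) _
      rw [if_pos hiN]
      split_ifs <;> linarith
    · rw [if_neg hiN, zero_add]
      split_ifs with h
      · rw [indicator_of_mem (shift_iterate_mem_longPattern hD hN (not_le.1 hiN) h)]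
      · exact indicator_nonneg (fun _ _ => zero_le_one) _
  · rw [cesaro_add]
    exact le_of_eq rfl

theorem ae_tendsto_empiricalMeasure [lam.IsOpenPosMeasure] (hlam : Ergodic shift lam)
    (hD : Monotone D) :
    ∀ᵐ x ∂lam, Tendsto (empiricalMeasure (eraseShift D) x) atTop
      (𝓝 (erasedMeasure (⋃ n, D n) lam).toFiniteMeasure) := by
  set S := ⋃ n, D n
  obtain ⟨s, hsc, hsd⟩ := TopologicalSpace.exists_countable_dense C(BinSeq, ℝ)
  have hb : ∀ᵐ x ∂lam, ∀ g ∈ s, Tendsto (fun n => birkhoffAverage ℝ shift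
      (fun y => g (erase (fun _ => S) y)) n x) atTop
      (𝓝 (∫ y, g y ∂(erasedMeasure S lam : Measure BinSeq))) := by
    refine (ae_ball_iff hsc).2 fun g _ => ?_
    have hm : Measurable fun y => g (erase (fun _ => S) y) :=
      g.continuous.measurable.comp (measurable_erase _)
    rw [coe_erasedMeasure, integral_map (measurable_erase _).aemeasurable
      g.continuous.measurable.aestronglyMeasurable]
    exact ae_tendsto_birkhoffAverage hlam hm (Integrable.of_bound hm.aestronglyMeasurable ‖g‖
      (Eventually.of_forall fun y => g.norm_coe_le_norm _))
  filter_upwards [hb, ae_tendsto_cesaro_disagreement hlam hD] with x hx hagree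
  refine tendsto_empiricalMeasure_iff.2 (tendsto_cesaro_of_dense hsd fun g hg => ?_)
  have h1 := tendsto_cesaro_sub_of_agree g hagree
  have h2 : Tendsto (cesaro fun i => g (erase (fun _ => S) (shift^[i] x))) atTop
      (𝓝 (∫ y, g y ∂(erasedMeasure S lam : Measure BinSeq))) := hx g hg
  have h3 := h1.add h2
  rw [zero_add] at h3
  exact h3.congr fun n => sub_add_cancel _ _

theorem isPhysicalMeasure_erasedMeasure [lam.IsOpenPosMeasure] (hlam : Ergodic shift lam)
    (hD : Monotone D) :
    IsPhysicalMeasure (eraseShift D) lam (erasedMeasure (⋃ n, D n) lam) :=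
  ⟨measurePreserving_eraseShift_erasedMeasure hlam (subset_iUnion D),
    ae_tendsto_empiricalMeasure hlam hD⟩

theorem IsPhysicalMeasure.unique {T : BinSeq → BinSeq} {μ ν : ProbabilityMeasure BinSeq}
    (hμ : IsPhysicalMeasure T lam μ) (hν : IsPhysicalMeasure T lam ν) : μ = ν := by
  obtain ⟨x, h1, h2⟩ := (hμ.2.and hν.2).exists
  have := tendsto_nhds_unique h1 h2
  exact Subtype.ext (congrArg (fun ρ : FiniteMeasure BinSeq => (ρ : Measure BinSeq)) this)

theorem isMetricAttractor_avoiding [lam.IsOpenPosMeasure] (hlam : Ergodic shift lam)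
    (hD : Monotone D) : IsMetricAttractor (eraseShift D) lam (avoiding (⋃ n, D n)) := by
  refine ⟨isClosed_avoiding _, ?_, fun A' hA' hss => ?_⟩
  · have : realm (eraseShift D) (avoiding (⋃ n, D n)) = univ :=
      eq_univ_of_forall fun x => omegaSet_eraseShift_subset hD x
    simp [this]
  · obtain ⟨y, hyA, n, hn⟩ := exists_cylinder_of_ssubset hA' hss
    refine measure_mono_null ?_ (ae_iff.1 (ae_tendsto_empiricalMeasure hlam hD))
    intro x hx hlim
    set W := cylinder (prefixWord y n)
    have hW : IsClopen W := isClopen_cylinder _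
    let g : C(BinSeq, ℝ) := ⟨W.indicator fun _ => (1 : ℝ), hW.continuous_indicator continuous_const⟩
    have h1 := tendsto_empiricalMeasure_iff.1 hlim g
    have h2 : Tendsto (cesaro fun i => g ((eraseShift D)^[i] x)) atTop (𝓝 0) := by
      refine tendsto_cesaro_of_eventually_eq_zero ?_
      filter_upwards [hn _ x hx] with t ht
      exact indicator_of_notMem ht (fun _ => (1 : ℝ))
    have h3 : ∫ z, g z ∂(erasedMeasure (⋃ n, D n) lam : Measure BinSeq) =
        (erasedMeasure (⋃ n, D n) lam : Measure BinSeq).real W := by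
      change ∫ z, W.indicator (fun _ => (1 : ℝ)) z ∂_ = _
      rw [integral_indicator hW.isOpen.measurableSet]
      simp
    have h4 := tendsto_nhds_unique h1 h2
    rw [h3] at h4
    have h5 := erasedMeasure_cylinder_pos (lam := lam) hyA n
    exact (ENNReal.toReal_pos h5.ne' (measure_ne_top _ _)).ne' h4

theorem meetsCylinder_avoiding_iff_pos [lam.IsOpenPosMeasure] {w : List Bool} :
    MeetsCylinder (avoiding S) w ↔
      0 < (erasedMeasure S lam : Measure BinSeq).real (cylinder w) := by
  rw [measureReal_def, ENNReal.toReal_pos_iff]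
  simp only [measure_lt_top, and_true]
  constructor
  · rintro ⟨y, hyw, hy⟩
    have : prefixWord y w.length = w := hyw
    rw [← this]
    exact erasedMeasure_cylinder_pos hy _
  · intro h
    obtain ⟨y, hyw, hy⟩ := Measure.nonempty_inter_support_of_pos h
    rw [support_erasedMeasure] at hy
    exact ⟨y, hyw, hy⟩

end Physical

theorem mainTheorem2 :
    ∃ (T : BinSeq → BinSeq) (A : Set BinSeq),
      IsComputableMap T ∧ IsSubshift A ∧ T '' A = A ∧
      IsPiOneComplete A ∧
      IsTopologicalAttractor T A ∧
      (EqOn T shift A ∧ IsTopologicallyMixingOn T A ∧ 0 < Dynamics.coverEntropy T A) ∧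
      (IsStronglyAttracting T A ∧ ∀ x, omegaSet T x ⊆ A) ∧
      ∀ lam : Measure BinSeq, IsProbabilityMeasure lam → Ergodic shift lam →
        lam.IsOpenPosMeasure →
          IsMetricAttractor T lam A ∧
          IsStatisticalAttractor T lam A ∧
          (∃! μ : ProbabilityMeasure BinSeq, IsPhysicalMeasure T lam μ) ∧
          ∀ μ : ProbabilityMeasure BinSeq, IsPhysicalMeasure T lam μ →
            ¬ IsComputableMeasure μ := by
  have hS : ∀ n, haltStage n ⊆ haltSet := subset_iUnion haltStage
  have hD := haltStage_mono
  have hT := isComputableMap_eraseShift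
  refine ⟨eraseShift haltStage, avoiding haltSet, hT, isSubshift_avoiding _,
    eraseShift_image_avoiding hS, isPiOneComplete_avoiding_haltSet,
    isTopologicalAttractor_avoiding hD (continuous_of_isComputableMap hT),
    ⟨eraseShift_eqOn hS, isTopologicallyMixingOn_avoiding hS,
      coverEntropy_pos_of_eqOn_shift (eraseShift_iterate_eqOn hS)⟩,
    ⟨isStronglyAttracting_avoiding hD, omegaSet_eraseShift_subset hD⟩, ?_⟩
  intro lam _ hlam _
  have hphys : IsPhysicalMeasure (eraseShift haltStage) lam (erasedMeasure haltSet lam) :=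
    isPhysicalMeasure_erasedMeasure hlam hD
  refine ⟨isMetricAttractor_avoiding hlam hD, ⟨isClosed_avoiding _, erasedMeasure haltSet lam,
    ⟨hphys, support_erasedMeasure⟩, fun μ hμ => hμ.1.unique hphys⟩,
    ⟨erasedMeasure haltSet lam, hphys, fun μ hμ => hμ.unique hphys⟩, fun μ hμ hcomp => ?_⟩
  rw [hμ.unique hphys] at hcomp
  exact not_rePred_meetsCylinder_avoiding_haltSet
    (hcomp.rePred_pos.of_eq fun w => meetsCylinder_avoiding_iff_pos.symm)
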